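/- Let $Q$ be a smooth manifold of dimension $n$ (without boundary), $L:TQ\to\mathbb R$ a smooth Lagrangian, and $M\subseteq TQ$ an embedded submanifold of codimension $m$ (locally $M=\{\Phi^1=\dots=\Phi^m=0\}$ with independent differentials). Let $S=dq^A\otimes\partial/\partial\dot q^A$ be the vertical endomorphism of $T(TQ)$, $S^*$ its transpose, and let $(T_vM)^o\subseteq T^*_v(TQ)$ be the annihilator of $T_vM$. Assume $M$ is admissible: $\dim (T_vM)^o=\dim S^*((T_vM)^o)$ for all $v\in M$. Let $\mathrm{Leg}_L:TQ\to T^*Q$ be the fibre derivative of $L$, $E_L(v)=\langle \mathrm{Leg}_L(v),v\rangle-L(v)$ the energy, and $\omega_L=-d(S^*dL)$. On $T^*Q\oplus TQ$, with projections $pr_1,pr_2$, let $\Omega=pr_1^*\omega_Q$, where $\omega_Q=dq^A\wedge dp_A$ is the canonical symplectic form of $T^*Q$, and $H=\langle pr_1,pr_2\rangle-L\circ pr_2$. Put $W_0=T^*Q\times_QM=pr_2^{-1}(M)$ and $$\tilde M=\{(p,v)\in W_0 : p=\mathrm{Leg}_L(v)\},\qquad g(v)=(\mathrm{Leg}_L(v),v).$$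 For $v\in M$ and $\Gamma\in T_v(TQ)$ consider the nonholonomic equations (Chetaev's principle) $$\text{(N)}\qquad (i_\Gamma\omega_L-dE_L)(v)\in S^*((T_vM)^o),\qquad \Gamma\in T_vM,$$ and for $w\in W_0$ and $X\in T_w(T^*Q\oplus TQ)$ consider the Skinner–Rusk equations $$\text{(SR)}\qquad (i_X\Omega-dH)(w)\in pr_2^*\bigl(S^*((TM)^o)\bigr)_w,\qquad X\in T_wW_0 .$$ Call $\Gamma\in T_v(TQ)$ second-order if $T\tau_Q(\Gamma)=v$, where $\tau_Q:TQ\to Q$ is the projection. Then: 1. $\tilde M$ is the first constraint submanifold of (SR): for $w\in W_0$, there is an $X$ satisfying (SR) at $w$ if and only if $w\in\tilde M$. The same holds if the tangency condition $X\in T_wW_0$ is dropped. 2. $\tilde M$ is an embedded submanifold of $T^*Q\oplus TQ$ of codimension $n+m$, and $g$ restricts to a diffeomorphism $M\to\tilde M$ with inverse $pr_2|_{\tilde M}$. 3. For every $v\in M$ the map $T_vg$ restricts to a bijection from the set of second-order $\Gamma$ satisfying (N) at $v$ onto the set of $X\in T_{g(v)}\tilde M$ satisfying (SR) at $g(v)$.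 4. Let $\Gamma$ and $X$ be vector fields along $M$ and along $\tilde M$ that correspond under $g$: $X(g(v))=T_vg(\Gamma(v))$ for all $v\in M$. Then $\Gamma$ is second-order and satisfies (N) at all points of $M$ if and only if $X$ satisfies (SR) at all points of $\tilde M$. Moreover $\Gamma$ is tangent to $M$ if and only if $X$ is tangent to $\tilde M$, and $\Gamma$ is smooth on $M$ if and only if $X$ is smooth on $\tilde M$. 5. If $L$ is regular at the points of $M$ (the fibre Hessian $\partial^2L/\partial\dot q^A\partial\dot q^B$ is non-degenerate there), then every $\Gamma$ satisfying (N) at a point of $M$ is second-order; hence in 4, $\Gamma$ satisfies (N) on $M$ if and only if $X$ satisfies (SR) on $\tilde M$. 6. The dynamics lives on $\tilde M$: let $w:J\to T^*Q\oplus TQ$ be a differentiable curve on an open set $J\subseteq\mathbb R$. Then $w(t)\in W_0$ and $\dot w(t)$ satisfies (SR) at $w(t)$ for all $t\in J$ if and only if $v=pr_2\circ w$ is such that, for all $t\in J$, $w(t)=g(v(t))$, $v(t)\in M$, and $\dot v(t)$ is second-order and satisfies (N) at $v(t)$. -/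

import Mathlib

open Bundle Set
open scoped Manifold ContDiff Topology

noncomputable section

namespace NonholonomicSR

section Submanifolds

variable {V : Type*} [NormedAddCommGroup V] [NormedSpace ℝ V]
  {H : Type*} [TopologicalSpace H] (I : ModelWithCorners ℝ V H)
  {N : Type*} [TopologicalSpace N] [ChartedSpace H N]
  {V' : Type*} [NormedAddCommGroup V'] [NormedSpace ℝ V']
  {H' : Type*} [TopologicalSpace H'] (I' : ModelWithCorners ℝ V' H')
  {N' : Type*} [TopologicalSpace N'] [ChartedSpace H' N']

/-- `S` is an embedded smooth submanifold of codimension `k`: near each of its points it is the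
zero set of `k` smooth functions with linearly independent differentials. -/
def IsSubmanifold (S : Set N) (k : ℕ) : Prop :=
  ∀ x ∈ S, ∃ U : Set N, IsOpen U ∧ x ∈ U ∧ ∃ Φ : N → EuclideanSpace ℝ (Fin k),
    ContMDiffOn I 𝓘(ℝ, EuclideanSpace ℝ (Fin k)) ∞ Φ U ∧
    S ∩ U = {y ∈ U | Φ y = 0} ∧
    ∀ y ∈ S ∩ U, Function.Surjective (mfderiv I 𝓘(ℝ, EuclideanSpace ℝ (Fin k)) Φ y)

/-- The differential `df(x)` of a function, as a covector. -/
def differential (f : N → ℝ) (x : N) : TangentSpace I x →L[ℝ] ℝ :=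
  (NormedSpace.fromTangentSpace (𝕜 := ℝ) (f x)).toContinuousLinearMap ∘L mfderiv I 𝓘(ℝ, ℝ) f x

/-- The tangent space `T_x S` of a submanifold: the vectors killed by the differential of every
smooth function that is defined near `x` and vanishes on `S`. -/
def tangentTo (S : Set N) (x : N) : Submodule ℝ (TangentSpace I x) where
  carrier := {ξ | ∀ (U : Set N) (f : N → ℝ), IsOpen U → x ∈ U →
    ContMDiffOn I 𝓘(ℝ, ℝ) ∞ f U → (∀ y ∈ S ∩ U, f y = 0) → differential I f x ξ = 0}
  zero_mem' := by intro U f _ _ _ _; simp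
  add_mem' := by
    intro a b ha hb U f h1 h2 h3 h4
    rw [map_add, ha U f h1 h2 h3 h4, hb U f h1 h2 h3 h4, add_zero]
  smul_mem' := by
    intro c a ha U f h1 h2 h3 h4
    rw [map_smul, ha U f h1 h2 h3 h4, smul_zero]

/-- The annihilator `(T_x S)° ⊆ T_x^* N`. -/
def conormal (S : Set N) (x : N) : Submodule ℝ (TangentSpace I x →L[ℝ] ℝ) where
  carrier := {α | ∀ ξ ∈ tangentTo I S x, α ξ = 0}
  zero_mem' := by intro ξ _; simp
  add_mem' := by
    intro a b ha hb ξ hξ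
    simp [ha ξ hξ, hb ξ hξ]
  smul_mem' := by
    intro c a ha ξ hξ
    simp [ha ξ hξ]

/-- `f` restricts to a diffeomorphism `S → T` with inverse the restriction of `g`. -/
structure IsDiffeoBetween (f : N → N') (g : N' → N) (S : Set N) (T : Set N') : Prop where
  mapsTo : MapsTo f S T
  mapsTo_inv : MapsTo g T S
  invOn : InvOn g f S T
  smooth : ContMDiffOn I I' ∞ f S
  smooth_inv : ContMDiffOn I' I ∞ g T

/-- The velocity `ċ(t)` of a curve. -/
def velocity (c : ℝ → N) (t : ℝ) : TangentSpace I (c t) :=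
  mfderiv 𝓘(ℝ, ℝ) I c t ((NormedSpace.fromTangentSpace (𝕜 := ℝ) t).symm 1)

/-- A one-form read in the preferred chart at `x`. -/
def chartForm (θ : ∀ y : N, TangentSpace I y →L[ℝ] ℝ) (x : N) (z : V) : V →L[ℝ] ℝ :=
  θ ((extChartAt I x).symm z) ∘L mfderiv 𝓘(ℝ, V) I (extChartAt I x).symm z ∘L
    (NormedSpace.fromTangentSpace (𝕜 := ℝ) z).symm.toContinuousLinearMap

/-- The differential at `x` of the preferred chart at `x`. -/
def dchart (x : N) : TangentSpace I x →L[ℝ] V :=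
  (NormedSpace.fromTangentSpace (𝕜 := ℝ) (extChartAt I x x)).toContinuousLinearMap ∘L
    mfderiv I 𝓘(ℝ, V) (extChartAt I x) x

/-- The exterior derivative of a one-form (on a manifold without boundary), computed in the
preferred chart at `x`: `dθ(ξ, η) = D_ξ θ (η) - D_η θ (ξ)`. -/
def extDer (θ : ∀ y : N, TangentSpace I y →L[ℝ] ℝ) (x : N) :
    TangentSpace I x →ₗ[ℝ] (TangentSpace I x →L[ℝ] ℝ) where
  toFun ξ :=
    fderiv ℝ (chartForm I θ x) (extChartAt I x x) (dchart I x ξ) ∘L dchart I x -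
      (fderiv ℝ (chartForm I θ x) (extChartAt I x x)).flip (dchart I x ξ) ∘L dchart I x
  map_add' := by
    intro ξ η
    ext ζ
    simp
    ring
  map_smul' := by
    intro c ξ
    ext ζ
    simp
    ring

theorem extDer_apply (θ : ∀ y : N, TangentSpace I y →L[ℝ] ℝ) (x : N)
    (ξ η : TangentSpace I x) :
    extDer I θ x ξ η =
      fderiv ℝ (chartForm I θ x) (extChartAt I x x) (dchart I x ξ) (dchart I x η) -
        fderiv ℝ (chartForm I θ x) (extChartAt I x x) (dchart I x η) (dchart I x ξ) :=
  rfl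

end Submanifolds

section Mechanics

variable {E : Type*} [NormedAddCommGroup E] [NormedSpace ℝ E]

/-- The cotangent bundle `T*Q`. -/
abbrev CotangentBundle (E : Type*) [NormedAddCommGroup E] [NormedSpace ℝ E]
    (Q : Type*) [TopologicalSpace Q] [ChartedSpace E Q] [IsManifold 𝓘(ℝ, E) ∞ Q] :=
  TotalSpace (E →L[ℝ] ℝ) (fun q : Q => TangentSpace 𝓘(ℝ, E) q →L[ℝ] ℝ)

/-- The Whitney sum `T*Q ⊕ TQ`. -/
abbrev WhitneySum (E : Type*) [NormedAddCommGroup E] [NormedSpace ℝ E]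
    (Q : Type*) [TopologicalSpace Q] [ChartedSpace E Q] [IsManifold 𝓘(ℝ, E) ∞ Q] :=
  TotalSpace ((E →L[ℝ] ℝ) × E)
    ((fun q : Q => TangentSpace 𝓘(ℝ, E) q →L[ℝ] ℝ) ×ᵇ (TangentSpace 𝓘(ℝ, E) : Q → Type _))

/-- The models with corners of `TQ`, `T*Q` and `T*Q ⊕ TQ`. -/
abbrev modelT (E : Type*) [NormedAddCommGroup E] [NormedSpace ℝ E] :
    ModelWithCorners ℝ (E × E) (ModelProd E E) :=
  𝓘(ℝ, E).prod 𝓘(ℝ, E)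

abbrev modelC (E : Type*) [NormedAddCommGroup E] [NormedSpace ℝ E] :
    ModelWithCorners ℝ (E × (E →L[ℝ] ℝ)) (ModelProd E (E →L[ℝ] ℝ)) :=
  𝓘(ℝ, E).prod 𝓘(ℝ, E →L[ℝ] ℝ)

abbrev modelW (E : Type*) [NormedAddCommGroup E] [NormedSpace ℝ E] :
    ModelWithCorners ℝ (E × ((E →L[ℝ] ℝ) × E)) (ModelProd E ((E →L[ℝ] ℝ) × E)) :=
  𝓘(ℝ, E).prod 𝓘(ℝ, (E →L[ℝ] ℝ) × E)

variable {Q : Type*} [TopologicalSpace Q] [ChartedSpace E Q] [IsManifold 𝓘(ℝ, E) ∞ Q]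

/-! ### The Lagrangian side, on `TQ` -/

/-- The differential `T_v TQ → T_q Q` of the bundle projection. -/
def dproj (v : TangentBundle 𝓘(ℝ, E) Q) :
    TangentSpace (modelT E) v →L[ℝ] TangentSpace 𝓘(ℝ, E) v.proj :=
  mfderiv (modelT E) 𝓘(ℝ, E)
    (TotalSpace.proj : TangentBundle 𝓘(ℝ, E) Q → Q) v

/-- The vertical lift `T_q Q → T_v TQ`: the differential at `v` of the inclusion of the fibre. -/
def vertLift (v : TangentBundle 𝓘(ℝ, E) Q) :
    TangentSpace 𝓘(ℝ, E) v.proj →L[ℝ] TangentSpace (modelT E) v :=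
  mfderiv 𝓘(ℝ, E) (modelT E) (fun u : E => (⟨v.proj, u⟩ : TangentBundle 𝓘(ℝ, E) Q)) v.snd

/-- The vertical endomorphism `S = dq ⊗ ∂/∂q̇` of `T(TQ)`. -/
def vertEndo (v : TangentBundle 𝓘(ℝ, E) Q) :
    TangentSpace (modelT E) v →L[ℝ] TangentSpace (modelT E) v :=
  vertLift v ∘L dproj v

/-- The transpose `S*` acting on covectors. -/
def vertEndoDual (v : TangentBundle 𝓘(ℝ, E) Q) :
    (TangentSpace (modelT E) v →L[ℝ] ℝ) →ₗ[ℝ] (TangentSpace (modelT E) v →L[ℝ] ℝ) where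
  toFun α := α ∘L vertEndo v
  map_add' := by intro α β; ext ξ; simp
  map_smul' := by intro c α; ext ξ; simp

/-- The Legendre map `Leg_L(v) = ∂L/∂q̇ ∈ T_q^* Q` (fibre derivative of `L`). -/
def leg (L : TangentBundle 𝓘(ℝ, E) Q → ℝ) (v : TangentBundle 𝓘(ℝ, E) Q) :
    TangentSpace 𝓘(ℝ, E) v.proj →L[ℝ] ℝ :=
  differential (modelT E) L v ∘L vertLift v

/-- The energy `E_L = q̇ ∂L/∂q̇ - L`. -/
def energy (L : TangentBundle 𝓘(ℝ, E) Q → ℝ) (v : TangentBundle 𝓘(ℝ, E) Q) : ℝ :=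
  leg L v v.snd - L v

/-- The Poincaré–Cartan one-form `θ_L = S*(dL)`. -/
def thetaL (L : TangentBundle 𝓘(ℝ, E) Q → ℝ) (v : TangentBundle 𝓘(ℝ, E) Q) :
    TangentSpace (modelT E) v →L[ℝ] ℝ :=
  vertEndoDual v (differential (modelT E) L v)

/-- The Poincaré–Cartan two-form `ω_L = -dθ_L`; `omegaL L v Γ` is `i_Γ ω_L`. -/
def omegaL (L : TangentBundle 𝓘(ℝ, E) Q → ℝ) (v : TangentBundle 𝓘(ℝ, E) Q) :
    TangentSpace (modelT E) v →ₗ[ℝ] (TangentSpace (modelT E) v →L[ℝ] ℝ) :=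
  -extDer (modelT E) (thetaL L) v

/-- The constraint forces `S*((T_v M)°) ⊆ T_v^* TQ`. -/
def forces (M : Set (TangentBundle 𝓘(ℝ, E) Q)) (v : TangentBundle 𝓘(ℝ, E) Q) :
    Submodule ℝ (TangentSpace (modelT E) v →L[ℝ] ℝ) :=
  (conormal (modelT E) M v).map (vertEndoDual v)

/-- Admissibility: `dim (T_v M)° = dim S*((T_v M)°)` at all points of `M`. -/
def Admissible (M : Set (TangentBundle 𝓘(ℝ, E) Q)) : Prop :=
  ∀ v ∈ M, Module.finrank ℝ (conormal (modelT E) M v) = Module.finrank ℝ (forces M v)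

/-- `L` is regular at `v`: the fibre Hessian `∂²L/∂q̇∂q̇` is non-degenerate at `v`. -/
def RegularAt (L : TangentBundle 𝓘(ℝ, E) Q → ℝ) (v : TangentBundle 𝓘(ℝ, E) Q) : Prop :=
  let F : E → (E →L[ℝ] ℝ) := fun u => leg L ⟨v.proj, u⟩
  Function.Injective (fderiv ℝ F v.snd)

/-- The nonholonomic equations at `v`: `Γ ∈ T_v M` and `i_Γ ω_L - dE_L ∈ S*((T_v M)°)`. -/
def NonholonomicAt (L : TangentBundle 𝓘(ℝ, E) Q → ℝ) (M : Set (TangentBundle 𝓘(ℝ, E) Q))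
    (v : TangentBundle 𝓘(ℝ, E) Q) (Γ : TangentSpace (modelT E) v) : Prop :=
  omegaL L v Γ - differential (modelT E) (energy L) v ∈ forces M v ∧
    Γ ∈ tangentTo (modelT E) M v

/-- `Γ` is a second-order vector at `v`, i.e. `Tτ_Q(Γ) = v`. -/
def IsSecondOrderAt (v : TangentBundle 𝓘(ℝ, E) Q) (Γ : TangentSpace (modelT E) v) : Prop :=
  dproj v Γ = v.snd

/-! ### The Skinner–Rusk side, on `T*Q ⊕ TQ` -/

def pr₁ (w : WhitneySum E Q) : CotangentBundle E Q := ⟨w.proj, w.snd.1⟩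

def pr₂ (w : WhitneySum E Q) : TangentBundle 𝓘(ℝ, E) Q := ⟨w.proj, w.snd.2⟩

/-- The Liouville one-form of `T*Q`, `θ_α(ξ) = α(Tπ_Q ξ)`. -/
def liouville (α : CotangentBundle E Q) : TangentSpace (modelC E) α →L[ℝ] ℝ :=
  α.snd ∘L mfderiv (modelC E) 𝓘(ℝ, E) (TotalSpace.proj : CotangentBundle E Q → Q) α

/-- The canonical symplectic form `ω_Q = -dθ = dq ∧ dp` of `T*Q`. -/
def omegaQ (α : CotangentBundle E Q) :
    TangentSpace (modelC E) α →ₗ[ℝ] (TangentSpace (modelC E) α →L[ℝ] ℝ) :=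
  -extDer (modelC E) liouville α

/-- The contraction `i_X Ω` with the presymplectic form `Ω = pr₁^* ω_Q`. -/
def contractΩ (w : WhitneySum E Q) (X : TangentSpace (modelW E) w) :
    TangentSpace (modelW E) w →L[ℝ] ℝ :=
  omegaQ (pr₁ w) (mfderiv (modelW E) (modelC E) pr₁ w X) ∘L
    mfderiv (modelW E) (modelC E) pr₁ w

/-- The Hamiltonian `H = ⟨pr₁, pr₂⟩ - L ∘ pr₂`. -/
def hamiltonian (L : TangentBundle 𝓘(ℝ, E) Q → ℝ) (w : WhitneySum E Q) : ℝ :=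
  (pr₁ w).snd (pr₂ w).snd - L (pr₂ w)

/-- `T*Q ×_Q M = pr₂⁻¹(M)`. -/
def W₀ (M : Set (TangentBundle 𝓘(ℝ, E) Q)) : Set (WhitneySum E Q) := pr₂ ⁻¹' M

/-- `pr₂^*(S*((TM)°))` at `w`. -/
def liftedForces (M : Set (TangentBundle 𝓘(ℝ, E) Q)) (w : WhitneySum E Q) :
    Set (TangentSpace (modelW E) w →L[ℝ] ℝ) :=
  {β | ∃ α ∈ forces M (pr₂ w), β = α ∘L mfderiv (modelW E) (modelT E) pr₂ w}

/-- The first of the Skinner–Rusk equations at `w`: `i_X Ω - dH ∈ pr₂^*(S*((TM)°))`. -/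
def SkinnerRuskFormAt (L : TangentBundle 𝓘(ℝ, E) Q → ℝ) (M : Set (TangentBundle 𝓘(ℝ, E) Q))
    (w : WhitneySum E Q) (X : TangentSpace (modelW E) w) : Prop :=
  contractΩ w X - differential (modelW E) (hamiltonian L) w ∈ liftedForces M w

/-- The Skinner–Rusk equations at `w`: moreover `X ∈ T_w (T*Q ×_Q M)`. -/
def SkinnerRuskAt (L : TangentBundle 𝓘(ℝ, E) Q → ℝ) (M : Set (TangentBundle 𝓘(ℝ, E) Q))
    (w : WhitneySum E Q) (X : TangentSpace (modelW E) w) : Prop :=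
  SkinnerRuskFormAt L M w X ∧ X ∈ tangentTo (modelW E) (W₀ M) w

/-- The map `v ↦ (Leg_L(v), v)`. -/
def legGraph (L : TangentBundle 𝓘(ℝ, E) Q → ℝ) (v : TangentBundle 𝓘(ℝ, E) Q) :
    WhitneySum E Q :=
  ⟨v.proj, (leg L v, v.snd)⟩

/-- Its differential at `v`. -/
def dlegGraph (L : TangentBundle 𝓘(ℝ, E) Q → ℝ) (v : TangentBundle 𝓘(ℝ, E) Q) :
    TangentSpace (modelT E) v →L[ℝ] TangentSpace (modelW E) (legGraph L v) :=
  mfderiv (modelT E) (modelW E) (legGraph L) v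

/-- `M̃ = {(p, v) ∈ T*Q ×_Q M | p = Leg_L(v)}`. -/
def Mtilde (L : TangentBundle 𝓘(ℝ, E) Q → ℝ) (M : Set (TangentBundle 𝓘(ℝ, E) Q)) :
    Set (WhitneySum E Q) :=
  {w | w ∈ W₀ M ∧ w.snd.1 = leg L (pr₂ w)}

end Mechanics

end NonholonomicSR

end

open NonholonomicSR

noncomputable section

namespace NonholonomicSR

/-! ### Maps and one-forms read in preferred charts. -/

section Coordinates

variable {V : Type*} [NormedAddCommGroup V] [NormedSpace ℝ V]
  {H : Type*} [TopologicalSpace H] {I : ModelWithCorners ℝ V H}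
  {N : Type*} [TopologicalSpace N] [ChartedSpace H N]
  {V' : Type*} [NormedAddCommGroup V'] [NormedSpace ℝ V']
  {H' : Type*} [TopologicalSpace H'] {I' : ModelWithCorners ℝ V' H'}
  {N' : Type*} [TopologicalSpace N'] [ChartedSpace H' N']

/-! The whole argument is a coordinate comparison at one point. The tangent space at a point is the
model space, identified through the preferred chart there, so every differential can be read off a
coordinate expression in the charts centred at that point. Write ξ = (ξ_q, ξ_v) for vectors on TQ
and X = (X_q, X_p, X_v) for vectors on T*Q ⊕ TQ. The left side of (N), evaluated on η, is D²L(η, (0,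
Γ_q - v)) + (∂L/∂q - D(∂L/∂q̇)Γ)(η_q) (`nonholonomic_form_apply`), and the left side of (SR) is
η_p(X_q - v) + (∂L/∂q̇ - p)(η_v) + (∂L/∂q - X_p)(η_q). The forces are of the form η ↦ α(0, η_q) with
α conormal to M. Hence (SR) splits into p = Leg_L(v), X_q = v, and ∂L/∂q - X_p = α(0, ·)
(`skinnerRuskFormAt_iff`). For second-order Γ, (N) is the last equation with X_p replaced by
D(∂L/∂q̇)Γ (`nonholonomicAt_iff`). Since Tg(Γ) has exactly this momentum component, the two systems
agree along g (`skinnerRuskAt_iff`).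

The other ingredients are geometric. Admissibility makes T_vM project onto T_qQ, which gives
solvability on M̃ (`exists_mem_tangentTo_of_admissible`). Tangent vectors to pr₂⁻¹(M) are those
whose TQ-part is tangent to M (`mem_tangentTo_W₀_iff`). The map g ∘ pr₂ fixes M̃ pointwise, so Tg
and Tpr₂ are inverse on tangent vectors (`dlegGraph_mfderiv_pr₂`). Finally, (p - ∂L/∂q̇, Φ ∘ pr₂) is
a submersion at the points of M̃ and cuts it out locally (`isSubmanifold_Mtilde`). -/

theorem eventuallyEq_of_coord [I.Boundaryless] {F : N → N'} {x : N} {G : V → V'}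
    (h : ∀ᶠ z in 𝓝 (extChartAt I x x),
      F ((extChartAt I x).symm z) = (extChartAt I' (F x)).symm (G z)) :
    F =ᶠ[𝓝 x] fun y => (extChartAt I' (F x)).symm (G (extChartAt I x y)) := by
  filter_upwards [(continuousAt_extChartAt (I := I) x).eventually h,
    extChartAt_source_mem_nhds (I := I) x] with y hy hys
  rw [← hy, (extChartAt I x).left_inv hys]

theorem continuousAt_of_coord [I.Boundaryless] {F : N → N'} {x : N} {G : V → V'}
    (hG : ContinuousAt G (extChartAt I x x))
    (h0 : G (extChartAt I x x) = extChartAt I' (F x) (F x))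
    (h : ∀ᶠ z in 𝓝 (extChartAt I x x),
      F ((extChartAt I x).symm z) = (extChartAt I' (F x)).symm (G z)) :
    ContinuousAt F x := by
  refine ContinuousAt.congr ?_ (eventuallyEq_of_coord (I' := I') h).symm
  have h1 : ContinuousAt (fun y => G (extChartAt I x y)) x :=
    ContinuousAt.comp (f := extChartAt I x) (g := G) hG (continuousAt_extChartAt x)
  refine ContinuousAt.comp (f := fun y => G (extChartAt I x y))
    (g := (extChartAt I' (F x)).symm) ?_ h1
  rw [h0]
  exact continuousAt_extChartAt_symm (F x)

/-- The hypothesis involves only inverse charts, because those of the bundles have explicit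
formulas. Continuity of `G` and `h0` keep `G z` in the target of the chart at `F x`, where the
inverse chart can be undone. -/
theorem writtenInExtChartAt_eventuallyEq [I.Boundaryless] [I'.Boundaryless]
    {F : N → N'} {x : N} {G : V → V'}
    (hG : ContinuousAt G (extChartAt I x x))
    (h0 : G (extChartAt I x x) = extChartAt I' (F x) (F x))
    (h : ∀ᶠ z in 𝓝 (extChartAt I x x),
      F ((extChartAt I x).symm z) = (extChartAt I' (F x)).symm (G z)) :
    writtenInExtChartAt I I' x F =ᶠ[𝓝 (extChartAt I x x)] G := by
  have h2 : ∀ᶠ z in 𝓝 (extChartAt I x x), G z ∈ (extChartAt I' (F x)).target := by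
    apply hG.eventually
    rw [h0]
    exact extChartAt_target_mem_nhds (F x)
  filter_upwards [h, h2] with z hz hz2
  simp only [writtenInExtChartAt, Function.comp_apply, hz]
  exact (extChartAt I' (F x)).right_inv hz2

/-- The differential of a map read in the preferred charts. -/
theorem hasMFDerivAt_of_coord [I.Boundaryless] [I'.Boundaryless]
    {F : N → N'} {x : N} {G : V → V'} {D : V →L[ℝ] V'}
    (hG : HasFDerivAt G D (extChartAt I x x))
    (h0 : G (extChartAt I x x) = extChartAt I' (F x) (F x))
    (h : ∀ᶠ z in 𝓝 (extChartAt I x x),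
      F ((extChartAt I x).symm z) = (extChartAt I' (F x)).symm (G z)) :
    HasMFDerivAt I I' F x D := by
  exact ⟨continuousAt_of_coord hG.continuousAt h0 h, HasFDerivAt.hasFDerivWithinAt
    (hG.congr_of_eventuallyEq (writtenInExtChartAt_eventuallyEq hG.continuousAt h0 h))⟩

theorem contMDiffAt_of_coord [I.Boundaryless] [I'.Boundaryless]
    {F : N → N'} {x : N} {G : V → V'} {n : ℕ∞ω}
    (hG : ContDiffAt ℝ n G (extChartAt I x x))
    (h0 : G (extChartAt I x x) = extChartAt I' (F x) (F x))
    (h : ∀ᶠ z in 𝓝 (extChartAt I x x),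
      F ((extChartAt I x).symm z) = (extChartAt I' (F x)).symm (G z)) :
    ContMDiffAt I I' n F x := by
  rw [contMDiffAt_iff]
  refine ⟨continuousAt_of_coord hG.continuousAt h0 h, ?_⟩
  rw [I.range_eq_univ, contDiffWithinAt_univ]
  exact hG.congr_of_eventuallyEq (writtenInExtChartAt_eventuallyEq hG.continuousAt h0 h)

/-- The differential of a vector-valued map read in the preferred chart. -/
theorem hasMFDerivAt_of_coord_vec [I.Boundaryless]
    {F : N → V'} {x : N} {G : V → V'} {D : V →L[ℝ] V'}
    (hG : HasFDerivAt G D (extChartAt I x x))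
    (h : ∀ᶠ z in 𝓝 (extChartAt I x x), F ((extChartAt I x).symm z) = G z) :
    HasMFDerivAt I 𝓘(ℝ, V') F x D := by
  refine hasMFDerivAt_of_coord hG ?_ ?_
  · rw [← h.self_of_nhds, (extChartAt I x).left_inv (mem_extChartAt_source x)]
    rfl
  · exact h

theorem dchart_eq_id [IsManifold I 1 N] (x : N) :
    dchart I x = ContinuousLinearMap.id ℝ V := by
  unfold dchart
  rw [mfderiv_extChartAt_self]
  rfl

/-- As the preferred chart has identity differential at its centre, the exterior derivative is the
antisymmetrised derivative of the coordinate form. -/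
theorem extDer_eq [IsManifold I 1 N] (θ : ∀ y : N, TangentSpace I y →L[ℝ] ℝ) (x : N)
    {D : V →L[ℝ] V →L[ℝ] ℝ} (hD : HasFDerivAt (chartForm I θ x) D (extChartAt I x x))
    (ξ η : TangentSpace I x) :
    extDer I θ x ξ η = D (ξ : V) (η : V) - D (η : V) (ξ : V) := by
  have h := extDer_apply I θ x ξ η
  rw [hD.fderiv, dchart_eq_id] at h
  exact h

end Coordinates

/-! ### Functoriality of the tangent space of a subset. -/

section TangentTo

variable {V : Type*} [NormedAddCommGroup V] [NormedSpace ℝ V]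
  {H : Type*} [TopologicalSpace H] {I : ModelWithCorners ℝ V H}
  {N : Type*} [TopologicalSpace N] [ChartedSpace H N]
  {V' : Type*} [NormedAddCommGroup V'] [NormedSpace ℝ V']
  {H' : Type*} [TopologicalSpace H'] {I' : ModelWithCorners ℝ V' H'}
  {N' : Type*} [TopologicalSpace N'] [ChartedSpace H' N']

/-- A test function vanishing on `S'` pulls back to one vanishing on `S`; the chain rule does the
rest. -/
theorem mfderiv_mem_tangentTo {F : N → N'} {S : Set N} {S' : Set N'} {U : Set N} {x : N}
    (hU : IsOpen U) (hx : x ∈ U) (hF : ContMDiffOn I I' ∞ F U) (hS : ∀ y ∈ S ∩ U, F y ∈ S')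
    {ξ : TangentSpace I x} (hξ : ξ ∈ tangentTo I S x) :
    mfderiv I I' F x ξ ∈ tangentTo I' S' (F x) := by
  intro U' f hU' hxU' hf hfS
  have hFx : MDifferentiableAt I I' F x :=
    (hF.contMDiffAt (hU.mem_nhds hx)).mdifferentiableAt (by simp)
  have hfx : MDifferentiableAt I' 𝓘(ℝ, ℝ) f (F x) :=
    (hf.contMDiffAt (hU'.mem_nhds hxU')).mdifferentiableAt (by simp)
  have key := hξ (U ∩ F ⁻¹' U') (f ∘ F) (hF.continuousOn.isOpen_inter_preimage hU hU')
    ⟨hx, hxU'⟩ (hf.comp (hF.mono inter_subset_left) (fun y hy => hy.2))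
    (fun y hy => hfS _ ⟨hS y ⟨hy.1, hy.2.1⟩, hy.2.2⟩)
  unfold differential at key
  rw [mfderiv_comp x hfx hFx] at key
  exact key

theorem mem_tangentTo_univ {x : N} (ξ : TangentSpace I x) : ξ ∈ tangentTo I univ x := by
  intro U f hU hx _ hf0
  have h : f =ᶠ[𝓝 x] fun _ => 0 := by
    filter_upwards [hU.mem_nhds hx] with y hy using hf0 y ⟨mem_univ y, hy⟩
  have h2 : HasMFDerivAt I 𝓘(ℝ, ℝ) f x 0 := (hasMFDerivAt_const (0 : ℝ) x).congr_of_eventuallyEq h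
  have h3 : mfderiv I 𝓘(ℝ, ℝ) f x ξ = 0 := by rw [h2.mfderiv]; rfl
  exact h3

/-- The differential of a map fixing the points of `S` fixes the tangent vectors of `S`. -/
theorem mfderiv_eq_self_of_mem_tangentTo [IsManifold I ∞ N] {F : N → N} {S : Set N} {U : Set N}
    {x : N} (hU : IsOpen U) (hx : x ∈ U) (hxS : x ∈ S) (hF : ContMDiffOn I I ∞ F U)
    (hS : ∀ y ∈ S ∩ U, F y = y) {ξ : V} (hξ : ξ ∈ tangentTo I S x) :
    (mfderiv I I F x : V →L[ℝ] V) ξ = ξ := by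
  have hFx : MDifferentiableAt I I F x :=
    (hF.contMDiffAt (hU.mem_nhds hx)).mdifferentiableAt (by simp)
  have : IsManifold I 1 N := IsManifold.of_le (n := ∞) (by simp)
  -- The equality `F x = x` is only propositional, so the identity differential is prepared for any
  -- `y` equal to `x`.
  have hid : ∀ y, y = x →
      HasMFDerivAt I 𝓘(ℝ, V) (extChartAt I x) y (ContinuousLinearMap.id ℝ V) := by
    rintro y rfl
    have := (mdifferentiableAt_extChartAt (I := I) (mem_chart_source H y)).hasMFDerivAt
    rwa [mfderiv_extChartAt_self] at this
  have hFxx : F x = x := hS x ⟨hxS, hx⟩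
  have hd := (hid x rfl).sub ((hid (F x) hFxx).comp x hFx.hasMFDerivAt)
  let W : Set N := U ∩ (chartAt H x).source
  have hW : IsOpen W := hU.inter (chartAt H x).open_source
  have hFW : ContMDiffOn I I ∞ F W := hF.mono inter_subset_left
  let Y : Set N := W ∩ F ⁻¹' (chartAt H x).source
  have hY : IsOpen Y := hFW.continuousOn.isOpen_inter_preimage hW (chartAt H x).open_source
  have hsep : ∀ l : V →L[ℝ] ℝ, l ((mfderiv I I F x : V →L[ℝ] V) ξ) = l ξ := ?_
  · exact (SeparatingDual.eq_iff_forall_dual_eq (R := ℝ) (V := V)).2 hsep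
  intro l
  have h1 : ContMDiffOn I 𝓘(ℝ, V) ∞ (extChartAt I x) (chartAt H x).source :=
    contMDiffOn_extChartAt
  -- This function vanishes on `S` because `F` fixes `S`, and its differential at `x` is `l ∘ (id -
  -- dF)`. Functionals `l` separate points, so `dF ξ = ξ`.
  have key := hξ Y (fun y => l (extChartAt I x y - extChartAt I x (F y))) hY
    ⟨⟨hx, mem_chart_source H x⟩, by rw [mem_preimage, hFxx]; exact mem_chart_source H x⟩
    (l.contDiff.contMDiff.comp_contMDiffOn ((h1.mono fun y hy => hy.1.2).sub
      (h1.comp (hFW.mono inter_subset_left) fun y hy => hy.2)))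
    (fun y hy => by rw [hS y ⟨hy.1, hy.2.1.1⟩]; simp)
  have hl : HasMFDerivAt 𝓘(ℝ, V) 𝓘(ℝ, ℝ) l
      (extChartAt I x x - (extChartAt I x ∘ F) x) l := l.hasFDerivAt.hasMFDerivAt
  have h3 := (HasMFDerivAt.comp x hl hd).mfderiv
  unfold differential at key
  have h4 : mfderiv I 𝓘(ℝ, ℝ) (fun y => l (extChartAt I x y - extChartAt I x (F y))) x = _ := h3
  rw [h4] at key
  let D : V →L[ℝ] V := mfderiv I I F x
  have h5 : l (ξ - D ξ) = 0 := key
  rw [map_sub, sub_eq_zero] at h5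
  exact h5.symm

end TangentTo

/-! ### Explicit bundle charts of TQ, T*Q and T*Q ⊕ TQ. -/

section Charts

variable {E : Type*} [NormedAddCommGroup E] [NormedSpace ℝ E]
  {Q : Type*} [TopologicalSpace Q] [ChartedSpace E Q] [IsManifold 𝓘(ℝ, E) ∞ Q]

/-- The frame `E → T_q Q` of the preferred chart at `q₀`. -/
def frame (q₀ q : Q) : E →L[ℝ] TangentSpace 𝓘(ℝ, E) q :=
  (trivializationAt E (TangentSpace 𝓘(ℝ, E)) q₀).symmL ℝ q

/-- The inverse of `frame`. -/
def coframe (q₀ q : Q) : TangentSpace 𝓘(ℝ, E) q →L[ℝ] E :=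
  (trivializationAt E (TangentSpace 𝓘(ℝ, E)) q₀).continuousLinearMapAt ℝ q

theorem coframe_frame {q₀ q : Q} (hq : q ∈ (extChartAt 𝓘(ℝ, E) q₀).source) (u : E) :
    coframe q₀ q (frame q₀ q u) = u :=
  (trivializationAt E (TangentSpace 𝓘(ℝ, E)) q₀).continuousLinearMapAt_symmL
    (by simpa using hq) u

theorem frame_coframe {q₀ q : Q} (hq : q ∈ (extChartAt 𝓘(ℝ, E) q₀).source)
    (u : TangentSpace 𝓘(ℝ, E) q) : frame q₀ q (coframe q₀ q u) = u :=
  (trivializationAt E (TangentSpace 𝓘(ℝ, E)) q₀).symmL_continuousLinearMapAt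
    (by simpa using hq) u

theorem frame_self (q : Q) (u : E) : frame q q u = u := by
  unfold frame
  rw [TangentBundle.symmL_trivializationAt (mem_chart_source E q),
    mfderivWithin_range_extChartAt_symm]
  rfl

theorem coframe_self (q : Q) (u : E) : coframe q q u = u := by
  conv_lhs => rw [← frame_self q u]
  exact coframe_frame (mem_extChartAt_source q) u

theorem hasMFDerivAt_extChartAt_symm {q₀ : Q} {x : E}
    (hx : x ∈ (extChartAt 𝓘(ℝ, E) q₀).target) :
    HasMFDerivAt 𝓘(ℝ, E) 𝓘(ℝ, E) (extChartAt 𝓘(ℝ, E) q₀).symm x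
      (frame q₀ ((extChartAt 𝓘(ℝ, E) q₀).symm x) : E →L[ℝ] E) := by
  have h1 := mdifferentiableWithinAt_extChartAt_symm hx
  rw [ModelWithCorners.range_eq_univ, mdifferentiableWithinAt_univ] at h1
  have h2 := h1.hasMFDerivAt
  have h3 : (extChartAt 𝓘(ℝ, E) q₀).symm x ∈ (chartAt E q₀).source := by
    simpa using (extChartAt 𝓘(ℝ, E) q₀).map_target hx
  have h4 := TangentBundle.symmL_trivializationAt (I := 𝓘(ℝ, E)) h3
  rw [(extChartAt 𝓘(ℝ, E) q₀).right_inv hx, ModelWithCorners.range_eq_univ,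
    mfderivWithin_univ] at h4
  unfold frame
  rw [h4]
  exact h2

theorem symm_mem_baseSet {q₀ : Q} {x : E} (hx : x ∈ (extChartAt 𝓘(ℝ, E) q₀).target) :
    (extChartAt 𝓘(ℝ, E) q₀).symm x ∈ (trivializationAt E (TangentSpace 𝓘(ℝ, E)) q₀).baseSet := by
  have := (extChartAt 𝓘(ℝ, E) q₀).map_target hx
  rwa [extChartAt_source] at this

theorem trivializationAt_symm_eq_frame {q₀ q : Q}
    (hq : q ∈ (trivializationAt E (TangentSpace 𝓘(ℝ, E)) q₀).baseSet) (u : E) :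
    (trivializationAt E (TangentSpace 𝓘(ℝ, E)) q₀).symm q u = frame q₀ q u := by
  exact ((trivializationAt E (TangentSpace 𝓘(ℝ, E)) q₀).symmL_apply (R := ℝ) hq u).symm

theorem extChartAt_tangent_symm (v : TangentBundle 𝓘(ℝ, E) Q) {x : E}
    (hx : x ∈ (extChartAt 𝓘(ℝ, E) v.proj).target) (u : E) :
    (extChartAt (modelT E) v).symm (x, u) =
      ⟨(extChartAt 𝓘(ℝ, E) v.proj).symm x, frame v.proj _ u⟩ := by
  rw [FiberBundle.extChartAt, ← trivializationAt_symm_eq_frame (symm_mem_baseSet hx)]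
  exact ((trivializationAt E (TangentSpace 𝓘(ℝ, E)) v.proj).mk_symm (symm_mem_baseSet hx) u).symm

/-- The hom bundle is trivialised by precomposition with the frame, and coframe and frame are
inverse over the base set, so `p ∘ coframe` is sent to `p`. -/
theorem cotangent_trivializationAt_symm {q₀ q : Q}
    (hq : q ∈ (trivializationAt E (TangentSpace 𝓘(ℝ, E)) q₀).baseSet) (p : E →L[ℝ] ℝ) :
    (trivializationAt (E →L[ℝ] ℝ) (fun q : Q => TangentSpace 𝓘(ℝ, E) q →L[ℝ] ℝ) q₀).symm q p =
      p ∘L coframe q₀ q := by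
  have h := (trivializationAt (E →L[ℝ] ℝ) (fun q : Q => TangentSpace 𝓘(ℝ, E) q →L[ℝ] ℝ)
    q₀).symm_apply_apply_mk (b := q) ⟨hq, mem_univ _⟩ (p ∘L coframe q₀ q)
  rw [← h]
  congr 1
  rw [hom_trivializationAt_apply, ContinuousLinearMap.inCoordinates]
  ext u
  have h2 := (trivializationAt E (TangentSpace 𝓘(ℝ, E)) q₀).continuousLinearMapAt_symmL
    (R := ℝ) hq u
  simp only [ContinuousLinearMap.coe_comp, Function.comp_apply]
  change p u = _
  simp
  exact congrArg p h2.symm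

theorem extChartAt_cotangent_symm (α : CotangentBundle E Q) {x : E}
    (hx : x ∈ (extChartAt 𝓘(ℝ, E) α.proj).target) (p : E →L[ℝ] ℝ) :
    (extChartAt (modelC E) α).symm (x, p) =
      ⟨(extChartAt 𝓘(ℝ, E) α.proj).symm x, p ∘L coframe α.proj _⟩ := by
  rw [FiberBundle.extChartAt, ← cotangent_trivializationAt_symm (symm_mem_baseSet hx)]
  exact ((trivializationAt (E →L[ℝ] ℝ)
    (fun q : Q => TangentSpace 𝓘(ℝ, E) q →L[ℝ] ℝ) α.proj).mk_symm
      (b := (extChartAt 𝓘(ℝ, E) α.proj).symm x) ⟨symm_mem_baseSet hx, mem_univ _⟩ p).symm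

theorem extChartAt_whitney_symm (w : WhitneySum E Q) {x : E}
    (hx : x ∈ (extChartAt 𝓘(ℝ, E) w.proj).target) (p : E →L[ℝ] ℝ) (u : E) :
    (extChartAt (modelW E) w).symm (x, (p, u)) =
      ⟨(extChartAt 𝓘(ℝ, E) w.proj).symm x, (p ∘L coframe w.proj _, frame w.proj _ u)⟩ := by
  rw [FiberBundle.extChartAt, ← cotangent_trivializationAt_symm (symm_mem_baseSet hx),
    ← trivializationAt_symm_eq_frame (symm_mem_baseSet hx)]
  rfl

/-- The base set of the trivialisation is the chart domain itself, so the fibre bundle chart imposes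
no further restriction on the base coordinate. -/
theorem extChartAt_tangent_target (v : TangentBundle 𝓘(ℝ, E) Q) :
    (extChartAt (modelT E) v).target = (extChartAt 𝓘(ℝ, E) v.proj).target ×ˢ univ := by
  refine (FiberBundle.extChartAt_target (IB := 𝓘(ℝ, E)) v).trans ?_
  refine congrArg (· ×ˢ univ) (inter_eq_left.2 ?_)
  exact fun x hx => symm_mem_baseSet hx

theorem extChartAt_cotangent_target (α : CotangentBundle E Q) :
    (extChartAt (modelC E) α).target = (extChartAt 𝓘(ℝ, E) α.proj).target ×ˢ univ := by
  refine (FiberBundle.extChartAt_target (IB := 𝓘(ℝ, E)) α).trans ?_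
  refine congrArg (· ×ˢ univ) (inter_eq_left.2 ?_)
  exact fun x hx => ⟨symm_mem_baseSet hx, mem_univ _⟩

theorem extChartAt_whitney_target (w : WhitneySum E Q) :
    (extChartAt (modelW E) w).target = (extChartAt 𝓘(ℝ, E) w.proj).target ×ˢ univ := by
  refine (FiberBundle.extChartAt_target (IB := 𝓘(ℝ, E)) w).trans ?_
  refine congrArg (· ×ˢ univ) (inter_eq_left.2 ?_)
  exact fun x hx => ⟨⟨symm_mem_baseSet hx, mem_univ _⟩, symm_mem_baseSet hx⟩

/-- The fibre component of a tangent vector, in the preferred chart at its base point. -/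
def vel (v : TangentBundle 𝓘(ℝ, E) Q) : E := v.snd

/-- The fibre component of a covector, in the preferred chart at its base point. -/
def mom (α : CotangentBundle E Q) : E →L[ℝ] ℝ := α.snd

theorem extChartAt_eq_of_symm_eq {X Y : Type*} {e : PartialEquiv X Y} {x : X} {y : Y}
    (hy : y ∈ e.target) (h : e.symm y = x) : e x = y := by
  rw [← h, e.right_inv hy]

theorem extChartAt_tangent_self (v : TangentBundle 𝓘(ℝ, E) Q) :
    extChartAt (modelT E) v v = (extChartAt 𝓘(ℝ, E) v.proj v.proj, vel v) := by
  have hx := mem_extChartAt_target (I := 𝓘(ℝ, E)) v.proj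
  refine extChartAt_eq_of_symm_eq ?_ ?_
  · rw [extChartAt_tangent_target]
    exact ⟨hx, mem_univ _⟩
  · rw [extChartAt_tangent_symm v hx, extChartAt_to_inv]
    exact congrArg (TotalSpace.mk v.proj) (frame_self v.proj (vel v))

theorem extChartAt_cotangent_self (α : CotangentBundle E Q) :
    extChartAt (modelC E) α α = (extChartAt 𝓘(ℝ, E) α.proj α.proj, mom α) := by
  have hx := mem_extChartAt_target (I := 𝓘(ℝ, E)) α.proj
  refine extChartAt_eq_of_symm_eq ?_ ?_
  · rw [extChartAt_cotangent_target]
    exact ⟨hx, mem_univ _⟩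
  · rw [extChartAt_cotangent_symm α hx, extChartAt_to_inv]
    exact congrArg (TotalSpace.mk α.proj)
      (ContinuousLinearMap.ext fun (u : E) => congrArg (mom α) (coframe_self α.proj u))

theorem extChartAt_whitney_self (w : WhitneySum E Q) :
    extChartAt (modelW E) w w =
      (extChartAt 𝓘(ℝ, E) w.proj w.proj, (mom (pr₁ w), vel (pr₂ w))) := by
  have hx := mem_extChartAt_target (I := 𝓘(ℝ, E)) w.proj
  refine extChartAt_eq_of_symm_eq ?_ ?_
  · rw [extChartAt_whitney_target]
    exact ⟨hx, mem_univ _⟩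
  · rw [extChartAt_whitney_symm w hx, extChartAt_to_inv]
    exact congrArg (TotalSpace.mk w.proj) (Prod.ext
      (ContinuousLinearMap.ext fun (u : E) => congrArg (mom (pr₁ w)) (coframe_self w.proj u))
      (frame_self w.proj (vel (pr₂ w))))

end Charts

/-! ### Differentials of the projections and the vertical endomorphism. -/

section Differentials

variable {E : Type*} [NormedAddCommGroup E] [NormedSpace ℝ E]
  {Q : Type*} [TopologicalSpace Q] [ChartedSpace E Q] [IsManifold 𝓘(ℝ, E) ∞ Q]

theorem eventually_tangent_target (v : TangentBundle 𝓘(ℝ, E) Q) :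
    ∀ᶠ z in 𝓝 (extChartAt (modelT E) v v), z.1 ∈ (extChartAt 𝓘(ℝ, E) v.proj).target := by
  have h := extChartAt_target_mem_nhds (I := modelT E) v
  rw [extChartAt_tangent_target] at h
  filter_upwards [h] with z hz using hz.1

theorem eventually_cotangent_target (α : CotangentBundle E Q) :
    ∀ᶠ z in 𝓝 (extChartAt (modelC E) α α), z.1 ∈ (extChartAt 𝓘(ℝ, E) α.proj).target := by
  have h := extChartAt_target_mem_nhds (I := modelC E) α
  rw [extChartAt_cotangent_target] at h
  filter_upwards [h] with z hz using hz.1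

theorem eventually_whitney_target (w : WhitneySum E Q) :
    ∀ᶠ z in 𝓝 (extChartAt (modelW E) w w), z.1 ∈ (extChartAt 𝓘(ℝ, E) w.proj).target := by
  have h := extChartAt_target_mem_nhds (I := modelW E) w
  rw [extChartAt_whitney_target] at h
  filter_upwards [h] with z hz using hz.1

theorem hasMFDerivAt_proj (v : TangentBundle 𝓘(ℝ, E) Q) :
    HasMFDerivAt (modelT E) 𝓘(ℝ, E) (TotalSpace.proj : TangentBundle 𝓘(ℝ, E) Q → Q) v
      (ContinuousLinearMap.fst ℝ E E) := by
  refine hasMFDerivAt_of_coord hasFDerivAt_fst ?_ ?_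
  · rw [extChartAt_tangent_self]
  · filter_upwards [eventually_tangent_target v] with z hz
    rw [extChartAt_tangent_symm v hz]

theorem hasMFDerivAt_cotangent_proj (α : CotangentBundle E Q) :
    HasMFDerivAt (modelC E) 𝓘(ℝ, E) (TotalSpace.proj : CotangentBundle E Q → Q) α
      (ContinuousLinearMap.fst ℝ E (E →L[ℝ] ℝ)) := by
  refine hasMFDerivAt_of_coord hasFDerivAt_fst ?_ ?_
  · rw [extChartAt_cotangent_self]
  · filter_upwards [eventually_cotangent_target α] with z hz
    rw [extChartAt_cotangent_symm α hz]

theorem tangent_mk_eq (q : Q) (u u' : E) :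
    (⟨q, u'⟩ : TangentBundle 𝓘(ℝ, E) Q) =
      (extChartAt (modelT E) (⟨q, u⟩ : TangentBundle 𝓘(ℝ, E) Q)).symm
        (extChartAt 𝓘(ℝ, E) q q, u') := by
  have hx := mem_extChartAt_target (I := 𝓘(ℝ, E)) q
  have h1 := extChartAt_tangent_symm (⟨q, u⟩ : TangentBundle 𝓘(ℝ, E) Q) hx u'
  rw [h1, extChartAt_to_inv]
  exact congrArg (fun z : E => (⟨q, z⟩ : TangentBundle 𝓘(ℝ, E) Q)) (frame_self q u').symm

theorem hasMFDerivAt_fibre (q : Q) (u : E) :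
    HasMFDerivAt 𝓘(ℝ, E) (modelT E) (fun u : E => (⟨q, u⟩ : TangentBundle 𝓘(ℝ, E) Q)) u
      (ContinuousLinearMap.inr ℝ E E) := by
  refine hasMFDerivAt_of_coord (G := fun u => (extChartAt 𝓘(ℝ, E) q q, u))
    (hasFDerivAt_prodMk_right _ u) ?_ ?_
  · rw [extChartAt_tangent_self]
    rfl
  · filter_upwards with u' using tangent_mk_eq q u u'

theorem hasMFDerivAt_pr₁ (w : WhitneySum E Q) :
    HasMFDerivAt (modelW E) (modelC E) pr₁ w
      ((ContinuousLinearMap.fst ℝ E ((E →L[ℝ] ℝ) × E)).prod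
        (ContinuousLinearMap.fst ℝ (E →L[ℝ] ℝ) E ∘L
          ContinuousLinearMap.snd ℝ E ((E →L[ℝ] ℝ) × E))) := by
  refine hasMFDerivAt_of_coord (ContinuousLinearMap.hasFDerivAt _) ?_ ?_
  · rw [extChartAt_whitney_self, extChartAt_cotangent_self]
    rfl
  · filter_upwards [eventually_whitney_target w] with z hz
    rw [extChartAt_whitney_symm w hz]
    exact (extChartAt_cotangent_symm (pr₁ w) hz _).symm

theorem hasMFDerivAt_pr₂ (w : WhitneySum E Q) :
    HasMFDerivAt (modelW E) (modelT E) pr₂ w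
      ((ContinuousLinearMap.fst ℝ E ((E →L[ℝ] ℝ) × E)).prod
        (ContinuousLinearMap.snd ℝ (E →L[ℝ] ℝ) E ∘L
          ContinuousLinearMap.snd ℝ E ((E →L[ℝ] ℝ) × E))) := by
  refine hasMFDerivAt_of_coord (ContinuousLinearMap.hasFDerivAt _) ?_ ?_
  · rw [extChartAt_whitney_self, extChartAt_tangent_self]
    rfl
  · filter_upwards [eventually_whitney_target w] with z hz
    rw [extChartAt_whitney_symm w hz]
    exact (extChartAt_tangent_symm (pr₂ w) hz _).symm

theorem contMDiff_pr₂ : ContMDiff (modelW E) (modelT E) ∞ (pr₂ : WhitneySum E Q → _) := by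
  intro w
  refine contMDiffAt_of_coord (ContinuousLinearMap.contDiff
    ((ContinuousLinearMap.fst ℝ E ((E →L[ℝ] ℝ) × E)).prod
        (ContinuousLinearMap.snd ℝ (E →L[ℝ] ℝ) E ∘L
          ContinuousLinearMap.snd ℝ E ((E →L[ℝ] ℝ) × E)))).contDiffAt ?_ ?_
  · rw [extChartAt_whitney_self, extChartAt_tangent_self]
    rfl
  · filter_upwards [eventually_whitney_target w] with z hz
    rw [extChartAt_whitney_symm w hz]
    exact (extChartAt_tangent_symm (pr₂ w) hz _).symm

theorem dproj_apply (v : TangentBundle 𝓘(ℝ, E) Q) (ξ : E × E) : dproj v ξ = ξ.1 := by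
  have h := (hasMFDerivAt_proj v).mfderiv
  unfold dproj
  rw [h]
  rfl

theorem vertLift_apply (v : TangentBundle 𝓘(ℝ, E) Q) (a : E) :
    vertLift v a = ((0, a) : E × E) := by
  have h := (hasMFDerivAt_fibre v.proj (vel v)).mfderiv
  have h2 : vertLift v = mfderiv 𝓘(ℝ, E) (modelT E)
    (fun u : E => (⟨v.proj, u⟩ : TangentBundle 𝓘(ℝ, E) Q)) (vel v) := rfl
  rw [h2, h]
  rfl

theorem vertEndo_apply (v : TangentBundle 𝓘(ℝ, E) Q) (ξ : E × E) :
    vertEndo v ξ = ((0, ξ.1) : E × E) :=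
  (congrArg (vertLift v) (dproj_apply v ξ)).trans (vertLift_apply v ξ.1)

end Differentials

/-! ### The Lagrangian, its Legendre map, ω_L and the energy in coordinates. -/

section LagrangianSide

variable {E : Type*} [NormedAddCommGroup E] [NormedSpace ℝ E]
  {Q : Type*} [TopologicalSpace Q] [ChartedSpace E Q] [IsManifold 𝓘(ℝ, E) ∞ Q]
  {L : TangentBundle 𝓘(ℝ, E) Q → ℝ}

/-- The Lagrangian read in the preferred chart at `v`. -/
def coordL (L : TangentBundle 𝓘(ℝ, E) Q → ℝ) (v : TangentBundle 𝓘(ℝ, E) Q) (z : E × E) : ℝ :=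
  L ((extChartAt (modelT E) v).symm z)

/-- The fibre derivative of the Lagrangian in the preferred chart at `v`. -/
def coordLeg (L : TangentBundle 𝓘(ℝ, E) Q → ℝ) (v : TangentBundle 𝓘(ℝ, E) Q) (z : E × E) :
    E →L[ℝ] ℝ :=
  fderiv ℝ (coordL L v) z ∘L ContinuousLinearMap.inr ℝ E E

/-- The second derivative at `v` of the Lagrangian in the preferred chart at `v`. -/
def hessL (L : TangentBundle 𝓘(ℝ, E) Q → ℝ) (v : TangentBundle 𝓘(ℝ, E) Q) :
    E × E →L[ℝ] E × E →L[ℝ] ℝ :=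
  fderiv ℝ (fderiv ℝ (coordL L v)) (extChartAt (modelT E) v v)

/-- The first derivative at `v` of the Lagrangian in the preferred chart at `v`. -/
def gradL (L : TangentBundle 𝓘(ℝ, E) Q → ℝ) (v : TangentBundle 𝓘(ℝ, E) Q) : E × E →L[ℝ] ℝ :=
  fderiv ℝ (coordL L v) (extChartAt (modelT E) v v)

theorem contDiffAt_coordL (hL : ContMDiff (modelT E) 𝓘(ℝ, ℝ) ∞ L) (v : TangentBundle 𝓘(ℝ, E) Q)
    {z : E × E} (hz : z.1 ∈ (extChartAt 𝓘(ℝ, E) v.proj).target) :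
    ContDiffAt ℝ ∞ (coordL L v) z := by
  have hz' : z ∈ (extChartAt (modelT E) v).target := by
    rw [extChartAt_tangent_target]
    exact ⟨hz, mem_univ _⟩
  have h := hL.comp_contMDiffOn (contMDiffOn_extChartAt_symm (I := modelT E) (n := ∞) v)
  exact (contMDiffOn_iff_contDiffOn.1 h).contDiffAt
    ((isOpen_extChartAt_target (I := modelT E) v).mem_nhds hz')

theorem contDiffAt_fderiv_coordL (hL : ContMDiff (modelT E) 𝓘(ℝ, ℝ) ∞ L)
    (v : TangentBundle 𝓘(ℝ, E) Q) {z : E × E}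
    (hz : z.1 ∈ (extChartAt 𝓘(ℝ, E) v.proj).target) :
    ContDiffAt ℝ ∞ (fderiv ℝ (coordL L v)) z :=
  (contDiffAt_coordL hL v hz).fderiv_right (by simp)

theorem contDiffAt_coordLeg (hL : ContMDiff (modelT E) 𝓘(ℝ, ℝ) ∞ L)
    (v : TangentBundle 𝓘(ℝ, E) Q) {z : E × E}
    (hz : z.1 ∈ (extChartAt 𝓘(ℝ, E) v.proj).target) :
    ContDiffAt ℝ ∞ (coordLeg L v) z :=
  (contDiffAt_fderiv_coordL hL v hz).clm_comp contDiffAt_const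

theorem mem_target_self (v : TangentBundle 𝓘(ℝ, E) Q) :
    (extChartAt (modelT E) v v).1 ∈ (extChartAt 𝓘(ℝ, E) v.proj).target := by
  rw [extChartAt_tangent_self]
  exact mem_extChartAt_target _

theorem hasFDerivAt_coordL (hL : ContMDiff (modelT E) 𝓘(ℝ, ℝ) ∞ L)
    (v : TangentBundle 𝓘(ℝ, E) Q) :
    HasFDerivAt (coordL L v) (gradL L v) (extChartAt (modelT E) v v) :=
  ((contDiffAt_coordL hL v (mem_target_self v)).differentiableAt (by simp)).hasFDerivAt

theorem hasFDerivAt_fderiv_coordL (hL : ContMDiff (modelT E) 𝓘(ℝ, ℝ) ∞ L)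
    (v : TangentBundle 𝓘(ℝ, E) Q) :
    HasFDerivAt (fderiv ℝ (coordL L v)) (hessL L v) (extChartAt (modelT E) v v) :=
  ((contDiffAt_fderiv_coordL hL v (mem_target_self v)).differentiableAt (by simp)).hasFDerivAt

theorem hessL_comm (hL : ContMDiff (modelT E) 𝓘(ℝ, ℝ) ∞ L) (v : TangentBundle 𝓘(ℝ, E) Q)
    (ξ η : E × E) : hessL L v ξ η = hessL L v η ξ :=
  ((contDiffAt_coordL hL v (mem_target_self v)).isSymmSndFDerivAt
    (by simpa using WithTop.coe_le_coe.2 (le_top : (2 : ℕ∞) ≤ ⊤))) ξ η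

/-- The derivative of the fibre derivative, in the preferred chart at `v`. -/
def dcoordLeg (L : TangentBundle 𝓘(ℝ, E) Q → ℝ) (v : TangentBundle 𝓘(ℝ, E) Q) :
    E × E →L[ℝ] E →L[ℝ] ℝ :=
  ((ContinuousLinearMap.compL ℝ E (E × E) ℝ).flip (ContinuousLinearMap.inr ℝ E E)) ∘L hessL L v

@[simp]
theorem dcoordLeg_apply (v : TangentBundle 𝓘(ℝ, E) Q) (ξ : E × E) (a : E) :
    dcoordLeg L v ξ a = hessL L v ξ (0, a) := rfl

theorem hasFDerivAt_coordLeg (hL : ContMDiff (modelT E) 𝓘(ℝ, ℝ) ∞ L)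
    (v : TangentBundle 𝓘(ℝ, E) Q) :
    HasFDerivAt (coordLeg L v) (dcoordLeg L v) (extChartAt (modelT E) v v) :=
  ((ContinuousLinearMap.compL ℝ E (E × E) ℝ).flip
    (ContinuousLinearMap.inr ℝ E E)).hasFDerivAt.comp _ (hasFDerivAt_fderiv_coordL hL v)

/-- On a fibre, the coordinate Lagrangian is `L` composed with the linear frame, so the chain rule
compares the two fibre derivatives. The formula is needed away from the centre of the chart because
θ_L and the energy are differentiated later; `v'` is kept as a variable to avoid rewriting in
dependent types. -/
theorem leg_frame (hL : ContMDiff (modelT E) 𝓘(ℝ, ℝ) ∞ L) (v : TangentBundle 𝓘(ℝ, E) Q)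
    {x : E} (hx : x ∈ (extChartAt 𝓘(ℝ, E) v.proj).target) (u : E)
    {v' : TangentBundle 𝓘(ℝ, E) Q}
    (hv' : v' = ⟨(extChartAt 𝓘(ℝ, E) v.proj).symm x, frame v.proj _ u⟩) (a : E) :
    leg L v' (frame v.proj v'.proj a) = coordLeg L v (x, u) a := by
  subst hv'
  set q := (extChartAt 𝓘(ℝ, E) v.proj).symm x with hq
  let A : E →L[ℝ] E := frame v.proj q
  have hA : HasMFDerivAt 𝓘(ℝ, E) 𝓘(ℝ, E) A u A := A.hasFDerivAt.hasMFDerivAt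
  have hv := (hasMFDerivAt_fibre (E := E) q (A u)).comp u hA
  have hd : MDifferentiableAt (modelT E) 𝓘(ℝ, ℝ) L (⟨q, A u⟩ : TangentBundle 𝓘(ℝ, E) Q) :=
    (hL _).mdifferentiableAt (by simp)
  have h1 := hd.hasMFDerivAt.comp u hv
  have h2 : HasFDerivAt (fun u' => coordL L v (x, u')) (coordLeg L v (x, u)) u :=
    (((contDiffAt_coordL hL v (z := (x, u)) hx).differentiableAt
      (by simp)).hasFDerivAt).comp u (hasFDerivAt_prodMk_right x u)
  have h3 : (fun u' => coordL L v (x, u')) =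
      L ∘ (fun u' : E => (⟨q, u'⟩ : TangentBundle 𝓘(ℝ, E) Q)) ∘ A := by
    funext u'
    unfold coordL
    rw [extChartAt_tangent_symm v hx]
    rfl
  rw [h3] at h2
  have h4 := hasMFDerivAt_unique h1 h2.hasMFDerivAt
  have h5 := congrArg (fun D : E →L[ℝ] ℝ => D a) h4
  refine Eq.trans ?_ h5
  exact congrArg (differential (modelT E) L (⟨q, A u⟩ : TangentBundle 𝓘(ℝ, E) Q))
    (vertLift_apply (⟨q, A u⟩ : TangentBundle 𝓘(ℝ, E) Q) (A a))

theorem leg_apply (hL : ContMDiff (modelT E) 𝓘(ℝ, ℝ) ∞ L) (v : TangentBundle 𝓘(ℝ, E) Q)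
    (a : E) : leg L v a = gradL L v (0, a) := by
  have h := leg_frame hL v (mem_extChartAt_target v.proj) (vel v) (v' := v) ?_ a
  · rw [frame_self] at h
    rw [h, ← extChartAt_tangent_self]
    rfl
  · have h2 : v = (extChartAt (modelT E) v).symm (extChartAt 𝓘(ℝ, E) v.proj v.proj, vel v) :=
      tangent_mk_eq v.proj (vel v) (vel v)
    exact h2.trans (extChartAt_tangent_symm v (mem_extChartAt_target v.proj) (vel v))

theorem dproj_mfderiv_extChartAt_symm (v : TangentBundle 𝓘(ℝ, E) Q) {z : E × E}
    (hz : z.1 ∈ (extChartAt 𝓘(ℝ, E) v.proj).target) (ξ : E × E) :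
    dproj ((extChartAt (modelT E) v).symm z)
      (mfderiv 𝓘(ℝ, E × E) (modelT E) (extChartAt (modelT E) v).symm z ξ) =
    frame v.proj ((extChartAt (modelT E) v).symm z).proj ξ.1 := by
  have hz' : z ∈ (extChartAt (modelT E) v).target := by
    rw [extChartAt_tangent_target]
    exact ⟨hz, mem_univ _⟩
  have h1 := mdifferentiableWithinAt_extChartAt_symm hz'
  rw [ModelWithCorners.range_eq_univ, mdifferentiableWithinAt_univ] at h1
  have h2 := (hasMFDerivAt_proj ((extChartAt (modelT E) v).symm z)).comp z h1.hasMFDerivAt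
  have h3 := (hasMFDerivAt_extChartAt_symm hz).comp z
    (hasFDerivAt_fst (𝕜 := ℝ) (p := z)).hasMFDerivAt
  have h4 : (TotalSpace.proj ∘ (extChartAt (modelT E) v).symm : E × E → Q) =ᶠ[𝓝 z]
      (extChartAt 𝓘(ℝ, E) v.proj).symm ∘ Prod.fst := by
    filter_upwards [(isOpen_extChartAt_target (I := modelT E) v).mem_nhds hz'] with y hy
    rw [extChartAt_tangent_target] at hy
    simp only [Function.comp_apply]
    rw [extChartAt_tangent_symm v hy.1]
  have h5 := hasMFDerivAt_unique h2 (h3.congr_of_eventuallyEq h4)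
  have h6 := congrArg (fun D : E × E →L[ℝ] E => D ξ) h5
  refine Eq.trans (dproj_apply _ _) (Eq.trans h6 ?_)
  rw [extChartAt_tangent_symm v hz]
  rfl

/-- θ_L(ξ) = Leg_L(Tτ ξ), and Tτ of the inverse bundle chart is the frame of the base chart; so θ_L
reads (∂L/∂q̇) dq. -/
theorem chartForm_thetaL (hL : ContMDiff (modelT E) 𝓘(ℝ, ℝ) ∞ L) (v : TangentBundle 𝓘(ℝ, E) Q)
    {z : E × E} (hz : z.1 ∈ (extChartAt 𝓘(ℝ, E) v.proj).target) :
    chartForm (modelT E) (thetaL L) v z = coordLeg L v z ∘L ContinuousLinearMap.fst ℝ E E := by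
  refine ContinuousLinearMap.ext fun ξ => ?_
  refine Eq.trans (b := leg L ((extChartAt (modelT E) v).symm z)
    (dproj ((extChartAt (modelT E) v).symm z)
      (mfderiv 𝓘(ℝ, E × E) (modelT E) (extChartAt (modelT E) v).symm z ξ))) rfl ?_
  rw [dproj_mfderiv_extChartAt_symm v hz]
  exact leg_frame hL v hz z.2 (extChartAt_tangent_symm v hz z.2) ξ.1

theorem omegaL_apply (hL : ContMDiff (modelT E) 𝓘(ℝ, ℝ) ∞ L) (v : TangentBundle 𝓘(ℝ, E) Q)
    (Γ η : E × E) : omegaL L v Γ η = hessL L v η (0, Γ.1) - hessL L v Γ (0, η.1) := by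
  have h1 : HasFDerivAt (chartForm (modelT E) (thetaL L) v)
      (((ContinuousLinearMap.compL ℝ (E × E) E ℝ).flip (ContinuousLinearMap.fst ℝ E E)) ∘L
        dcoordLeg L v) (extChartAt (modelT E) v v) := by
    refine HasFDerivAt.congr_of_eventuallyEq
      (((ContinuousLinearMap.compL ℝ (E × E) E ℝ).flip
        (ContinuousLinearMap.fst ℝ E E)).hasFDerivAt.comp _ (hasFDerivAt_coordLeg hL v)) ?_
    filter_upwards [eventually_tangent_target v] with z hz
    exact chartForm_thetaL hL v hz
  have : IsManifold (modelT E) 1 (TangentBundle 𝓘(ℝ, E) Q) := IsManifold.of_le (n := ∞) (by simp)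
  have h2 := extDer_eq (thetaL L) v h1 Γ η
  refine Eq.trans (congrArg Neg.neg h2) ?_
  exact neg_sub _ _

theorem differential_energy_apply (hL : ContMDiff (modelT E) 𝓘(ℝ, ℝ) ∞ L)
    (v : TangentBundle 𝓘(ℝ, E) Q) (η : E × E) :
    differential (modelT E) (energy L) v η = hessL L v η (0, vel v) - gradL L v (η.1, 0) := by
  have h1 := ((hasFDerivAt_coordLeg hL v).clm_apply
    (hasFDerivAt_snd (𝕜 := ℝ) (p := extChartAt (modelT E) v v))).sub (hasFDerivAt_coordL hL v)
  have h2 := (hasMFDerivAt_of_coord_vec (F := energy L) h1 ?_).mfderiv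
  · have h3 := congrArg (fun D : E × E →L[ℝ] ℝ => D η) h2
    refine Eq.trans h3 ?_
    have h4 : η = (η.1, 0) + (0, η.2) := by simp
    have h5 : coordLeg L v (extChartAt (modelT E) v v) η.2 = gradL L v (0, η.2) := rfl
    -- The fibre part of dL cancels against the term in which the factor q̇ of q̇ ∂L/∂q̇ is
    -- differentiated.
    have h6 : gradL L v η = gradL L v (η.1, 0) + gradL L v (0, η.2) := by
      rw [← map_add, ← h4]
    rw [sub_apply, add_apply,
      ContinuousLinearMap.comp_apply, ContinuousLinearMap.flip_apply, dcoordLeg_apply, h6,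
      ContinuousLinearMap.coe_snd', h5, extChartAt_tangent_self]
    ring
  · filter_upwards [eventually_tangent_target v] with z hz
    have h3 := leg_frame hL v hz z.2 (extChartAt_tangent_symm v hz z.2) z.2
    unfold energy
    refine congrArg₂ (· - ·) (Eq.trans ?_ h3) rfl
    refine congrArg (leg L _) ?_
    rw [extChartAt_tangent_symm v hz z.2]

end LagrangianSide

/-! ### The graph of the Legendre map, the form Ω and the Hamiltonian in coordinates. -/

section WhitneySide

variable {E : Type*} [NormedAddCommGroup E] [NormedSpace ℝ E]
  {Q : Type*} [TopologicalSpace Q] [ChartedSpace E Q] [IsManifold 𝓘(ℝ, E) ∞ Q]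
  {L : TangentBundle 𝓘(ℝ, E) Q → ℝ}

theorem leg_eq_comp_coframe (hL : ContMDiff (modelT E) 𝓘(ℝ, ℝ) ∞ L)
    (v : TangentBundle 𝓘(ℝ, E) Q) {x : E} (hx : x ∈ (extChartAt 𝓘(ℝ, E) v.proj).target) (u : E) :
    leg L (⟨(extChartAt 𝓘(ℝ, E) v.proj).symm x, frame v.proj _ u⟩ : TangentBundle 𝓘(ℝ, E) Q) =
      coordLeg L v (x, u) ∘L coframe v.proj ((extChartAt 𝓘(ℝ, E) v.proj).symm x) := by
  refine ContinuousLinearMap.ext fun b => ?_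
  have h := leg_frame hL v hx u rfl (coframe v.proj ((extChartAt 𝓘(ℝ, E) v.proj).symm x) b)
  rw [frame_coframe ((extChartAt 𝓘(ℝ, E) v.proj).map_target hx)] at h
  exact h

theorem leg_eq_coordLeg (hL : ContMDiff (modelT E) 𝓘(ℝ, ℝ) ∞ L)
    (v : TangentBundle 𝓘(ℝ, E) Q) : leg L v = coordLeg L v (extChartAt (modelT E) v v) :=
  ContinuousLinearMap.ext fun a => leg_apply hL v a

theorem legGraph_symm (hL : ContMDiff (modelT E) 𝓘(ℝ, ℝ) ∞ L)
    (v : TangentBundle 𝓘(ℝ, E) Q) {z : E × E}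
    (hz : z.1 ∈ (extChartAt 𝓘(ℝ, E) v.proj).target) :
    legGraph L ((extChartAt (modelT E) v).symm z) =
      (extChartAt (modelW E) (legGraph L v)).symm (z.1, (coordLeg L v z, z.2)) := by
  rw [extChartAt_whitney_symm (legGraph L v) hz, extChartAt_tangent_symm v hz]
  unfold legGraph
  rw [leg_eq_comp_coframe hL v hz]

theorem extChartAt_legGraph_self (hL : ContMDiff (modelT E) 𝓘(ℝ, ℝ) ∞ L)
    (v : TangentBundle 𝓘(ℝ, E) Q) :
    extChartAt (modelW E) (legGraph L v) (legGraph L v) =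
      ((extChartAt (modelT E) v v).1, (coordLeg L v (extChartAt (modelT E) v v),
        (extChartAt (modelT E) v v).2)) := by
  rw [extChartAt_whitney_self, ← leg_eq_coordLeg hL, extChartAt_tangent_self]
  rfl

/-- The differential of `legGraph` in the preferred charts. -/
def dlegGraphCoord (L : TangentBundle 𝓘(ℝ, E) Q → ℝ) (v : TangentBundle 𝓘(ℝ, E) Q) :
    E × E →L[ℝ] E × ((E →L[ℝ] ℝ) × E) :=
  (ContinuousLinearMap.fst ℝ E E).prod
    ((dcoordLeg L v).prod (ContinuousLinearMap.snd ℝ E E))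

theorem hasMFDerivAt_legGraph (hL : ContMDiff (modelT E) 𝓘(ℝ, ℝ) ∞ L)
    (v : TangentBundle 𝓘(ℝ, E) Q) :
    HasMFDerivAt (modelT E) (modelW E) (legGraph L) v (dlegGraphCoord L v) := by
  have h : HasFDerivAt (fun z : E × E => (z.1, (coordLeg L v z, z.2))) (dlegGraphCoord L v)
      (extChartAt (modelT E) v v) :=
    HasFDerivAt.prodMk (hasFDerivAt_fst (𝕜 := ℝ))
      ((hasFDerivAt_coordLeg hL v).prodMk (hasFDerivAt_snd (𝕜 := ℝ)))
  refine hasMFDerivAt_of_coord h ?_ ?_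
  · exact (extChartAt_legGraph_self hL v).symm
  · filter_upwards [eventually_tangent_target v] with z hz using legGraph_symm hL v hz

theorem contMDiff_legGraph (hL : ContMDiff (modelT E) 𝓘(ℝ, ℝ) ∞ L) :
    ContMDiff (modelT E) (modelW E) ∞ (legGraph L) := by
  intro v
  refine contMDiffAt_of_coord (G := fun z => (z.1, (coordLeg L v z, z.2)))
    (contDiffAt_fst.prodMk ((contDiffAt_coordLeg hL v (mem_target_self v)).prodMk
      contDiffAt_snd)) ?_ ?_
  · exact (extChartAt_legGraph_self hL v).symm
  · filter_upwards [eventually_tangent_target v] with z hz using legGraph_symm hL v hz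

theorem dlegGraph_apply (hL : ContMDiff (modelT E) 𝓘(ℝ, ℝ) ∞ L)
    (v : TangentBundle 𝓘(ℝ, E) Q) (Γ : E × E) :
    dlegGraph L v Γ = ((Γ.1, (dcoordLeg L v Γ, Γ.2)) : E × ((E →L[ℝ] ℝ) × E)) := by
  unfold dlegGraph
  rw [(hasMFDerivAt_legGraph hL v).mfderiv]
  rfl

theorem mfderiv_pr₁_apply (w : WhitneySum E Q) (X : E × ((E →L[ℝ] ℝ) × E)) :
    mfderiv (modelW E) (modelC E) pr₁ w X = ((X.1, X.2.1) : E × (E →L[ℝ] ℝ)) := by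
  rw [(hasMFDerivAt_pr₁ w).mfderiv]
  rfl

theorem mfderiv_pr₂_apply (w : WhitneySum E Q) (X : E × ((E →L[ℝ] ℝ) × E)) :
    mfderiv (modelW E) (modelT E) pr₂ w X = ((X.1, X.2.2) : E × E) := by
  rw [(hasMFDerivAt_pr₂ w).mfderiv]
  rfl

theorem mfderiv_cotangent_proj_extChartAt_symm (α : CotangentBundle E Q) {z : E × (E →L[ℝ] ℝ)}
    (hz : z.1 ∈ (extChartAt 𝓘(ℝ, E) α.proj).target) (ξ : E × (E →L[ℝ] ℝ)) :
    mfderiv (modelC E) 𝓘(ℝ, E) (TotalSpace.proj : CotangentBundle E Q → Q)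
      ((extChartAt (modelC E) α).symm z)
      (mfderiv 𝓘(ℝ, E × (E →L[ℝ] ℝ)) (modelC E) (extChartAt (modelC E) α).symm z ξ) =
    frame α.proj ((extChartAt (modelC E) α).symm z).proj ξ.1 := by
  have hz' : z ∈ (extChartAt (modelC E) α).target := by
    rw [extChartAt_cotangent_target]
    exact ⟨hz, mem_univ _⟩
  have h1 := mdifferentiableWithinAt_extChartAt_symm hz'
  rw [ModelWithCorners.range_eq_univ, mdifferentiableWithinAt_univ] at h1
  have h2 := (hasMFDerivAt_cotangent_proj ((extChartAt (modelC E) α).symm z)).comp z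
    h1.hasMFDerivAt
  have h3 := (hasMFDerivAt_extChartAt_symm hz).comp z
    (hasFDerivAt_fst (𝕜 := ℝ) (p := z)).hasMFDerivAt
  have h4 : (TotalSpace.proj ∘ (extChartAt (modelC E) α).symm : E × (E →L[ℝ] ℝ) → Q) =ᶠ[𝓝 z]
      (extChartAt 𝓘(ℝ, E) α.proj).symm ∘ Prod.fst := by
    filter_upwards [(isOpen_extChartAt_target (I := modelC E) α).mem_nhds hz'] with y hy
    rw [extChartAt_cotangent_target] at hy
    simp only [Function.comp_apply]
    rw [extChartAt_cotangent_symm α hy.1]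
  have h5 := hasMFDerivAt_unique h2 (h3.congr_of_eventuallyEq h4)
  have h6 := congrArg (fun D : E × (E →L[ℝ] ℝ) →L[ℝ] E => D ξ) h5
  rw [(hasMFDerivAt_cotangent_proj ((extChartAt (modelC E) α).symm z)).mfderiv]
  refine Eq.trans h6 ?_
  rw [extChartAt_cotangent_symm α hz]
  rfl

theorem snd_apply_frame (α : CotangentBundle E Q) {x : E}
    (hx : x ∈ (extChartAt 𝓘(ℝ, E) α.proj).target) (p : E →L[ℝ] ℝ) {α' : CotangentBundle E Q}
    (hα' : α' = ⟨(extChartAt 𝓘(ℝ, E) α.proj).symm x, p ∘L coframe α.proj _⟩) (a : E) :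
    α'.snd (frame α.proj α'.proj a) = p a := by
  subst hα'
  exact congrArg p (coframe_frame ((extChartAt 𝓘(ℝ, E) α.proj).map_target hx) a)

/-- The evaluation `(x, p) ↦ ((a, c) ↦ p a)`. -/
def liouvilleCoord (E : Type*) [NormedAddCommGroup E] [NormedSpace ℝ E] :
    E × (E →L[ℝ] ℝ) →L[ℝ] E × (E →L[ℝ] ℝ) →L[ℝ] ℝ :=
  ((ContinuousLinearMap.compL ℝ (E × (E →L[ℝ] ℝ)) E ℝ).flip
    (ContinuousLinearMap.fst ℝ E (E →L[ℝ] ℝ))) ∘L ContinuousLinearMap.snd ℝ E (E →L[ℝ] ℝ)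

set_option synthInstance.maxHeartbeats 200000 in
theorem hasFDerivAt_liouvilleCoord (z : E × (E →L[ℝ] ℝ)) :
    HasFDerivAt (liouvilleCoord E) (liouvilleCoord E) z :=
  ContinuousLinearMap.hasFDerivAt _

theorem chartForm_liouville (α : CotangentBundle E Q) {z : E × (E →L[ℝ] ℝ)}
    (hz : z.1 ∈ (extChartAt 𝓘(ℝ, E) α.proj).target) :
    chartForm (modelC E) liouville α z = liouvilleCoord E z := by
  refine ContinuousLinearMap.ext fun ξ => ?_
  refine Eq.trans (b := ((extChartAt (modelC E) α).symm z).snd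
    (mfderiv (modelC E) 𝓘(ℝ, E) (TotalSpace.proj : CotangentBundle E Q → Q)
      ((extChartAt (modelC E) α).symm z)
      (mfderiv 𝓘(ℝ, E × (E →L[ℝ] ℝ)) (modelC E) (extChartAt (modelC E) α).symm z ξ))) rfl ?_
  rw [mfderiv_cotangent_proj_extChartAt_symm α hz]
  exact snd_apply_frame α hz z.2 (extChartAt_cotangent_symm α hz z.2) ξ.1

/-- The Liouville form p dq is linear in the coordinates, hence is its own derivative;
antisymmetrising gives the constant form dq ∧ dp. -/
theorem omegaQ_apply (α : CotangentBundle E Q) (X η : E × (E →L[ℝ] ℝ)) :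
    omegaQ α X η = η.2 X.1 - X.2 η.1 := by
  have h1 : HasFDerivAt (chartForm (modelC E) liouville α) (liouvilleCoord E)
      (extChartAt (modelC E) α α) := by
    refine (hasFDerivAt_liouvilleCoord _).congr_of_eventuallyEq ?_
    filter_upwards [eventually_cotangent_target α] with z hz
    exact chartForm_liouville α hz
  have : IsManifold (modelC E) 1 (CotangentBundle E Q) := IsManifold.of_le (n := ∞) (by simp)
  have h2 := extDer_eq liouville α h1 X η
  refine Eq.trans (congrArg Neg.neg h2) ?_
  exact neg_sub _ _

theorem contractΩ_apply (w : WhitneySum E Q) (X η : E × ((E →L[ℝ] ℝ) × E)) :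
    contractΩ w X η = η.2.1 X.1 - X.2.1 η.1 := by
  refine Eq.trans (b := omegaQ (pr₁ w) (mfderiv (modelW E) (modelC E) pr₁ w X)
    (mfderiv (modelW E) (modelC E) pr₁ w η)) rfl ?_
  rw [mfderiv_pr₁_apply, mfderiv_pr₁_apply]
  exact omegaQ_apply (pr₁ w) (X.1, X.2.1) (η.1, η.2.1)

theorem differential_hamiltonian_apply (hL : ContMDiff (modelT E) 𝓘(ℝ, ℝ) ∞ L)
    (w : WhitneySum E Q) (η : E × ((E →L[ℝ] ℝ) × E)) :
    differential (modelW E) (hamiltonian L) w η =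
      η.2.1 (vel (pr₂ w)) + mom (pr₁ w) η.2.2 - gradL L (pr₂ w) (η.1, η.2.2) := by
  let P : E × ((E →L[ℝ] ℝ) × E) →L[ℝ] E × E := (ContinuousLinearMap.fst ℝ E ((E →L[ℝ] ℝ) × E)).prod
        (ContinuousLinearMap.snd ℝ (E →L[ℝ] ℝ) E ∘L
          ContinuousLinearMap.snd ℝ E ((E →L[ℝ] ℝ) × E))
  let P₁ : E × ((E →L[ℝ] ℝ) × E) →L[ℝ] (E →L[ℝ] ℝ) := ContinuousLinearMap.fst ℝ (E →L[ℝ] ℝ) E ∘L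
          ContinuousLinearMap.snd ℝ E ((E →L[ℝ] ℝ) × E)
  let P₂ : E × ((E →L[ℝ] ℝ) × E) →L[ℝ] E := ContinuousLinearMap.snd ℝ (E →L[ℝ] ℝ) E ∘L
          ContinuousLinearMap.snd ℝ E ((E →L[ℝ] ℝ) × E)
  have hP : P (extChartAt (modelW E) w w) = extChartAt (modelT E) (pr₂ w) (pr₂ w) := by
    rw [extChartAt_whitney_self, extChartAt_tangent_self]
    rfl
  have h0 := hasFDerivAt_coordL hL (pr₂ w)
  rw [← hP] at h0
  have h1 := ((P₁.hasFDerivAt (x := extChartAt (modelW E) w w)).clm_apply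
    (P₂.hasFDerivAt (x := extChartAt (modelW E) w w))).sub (h0.comp _ P.hasFDerivAt)
  have h2 := (hasMFDerivAt_of_coord_vec (F := hamiltonian L) h1 ?_).mfderiv
  · have h3 := congrArg (fun D : E × ((E →L[ℝ] ℝ) × E) →L[ℝ] ℝ => D η) h2
    refine Eq.trans h3 ?_
    have h5 : P₁ (extChartAt (modelW E) w w) = mom (pr₁ w) := by
      rw [extChartAt_whitney_self]; rfl
    have h6 : P₂ (extChartAt (modelW E) w w) = vel (pr₂ w) := by
      rw [extChartAt_whitney_self]; rfl
    rw [h5, h6, sub_apply, add_apply, ContinuousLinearMap.comp_apply,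
      ContinuousLinearMap.flip_apply, ContinuousLinearMap.comp_apply, add_comm]
    rfl
  · filter_upwards [eventually_whitney_target w] with z hz
    rw [extChartAt_whitney_symm w hz z.2.1 z.2.2]
    refine congrArg₂ (· - ·) ?_ (congrArg L (extChartAt_tangent_symm (pr₂ w) hz z.2.2).symm)
    exact congrArg z.2.1 (coframe_frame ((extChartAt 𝓘(ℝ, E) w.proj).map_target hz) z.2.2)

end WhitneySide

/-! ### The two systems of equations in coordinates. -/

section Equations

variable {E : Type*} [NormedAddCommGroup E] [NormedSpace ℝ E]
  {Q : Type*} [TopologicalSpace Q] [ChartedSpace E Q] [IsManifold 𝓘(ℝ, E) ∞ Q]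
  {L : TangentBundle 𝓘(ℝ, E) Q → ℝ} {M : Set (TangentBundle 𝓘(ℝ, E) Q)}

theorem vertEndoDual_apply (v : TangentBundle 𝓘(ℝ, E) Q)
    (α : TangentSpace (modelT E) v →L[ℝ] ℝ) (η : E × E) :
    vertEndoDual v α η = α ((0, η.1) : E × E) :=
  congrArg α (vertEndo_apply v η)

theorem isSecondOrderAt_iff (v : TangentBundle 𝓘(ℝ, E) Q) (Γ : E × E) :
    IsSecondOrderAt v Γ ↔ Γ.1 = vel v := by
  have h := dproj_apply v Γ
  exact ⟨fun h2 => h.symm.trans h2, fun h2 => h.trans h2⟩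

theorem nonholonomic_form_apply (hL : ContMDiff (modelT E) 𝓘(ℝ, ℝ) ∞ L)
    (v : TangentBundle 𝓘(ℝ, E) Q) (Γ η : E × E) :
    (omegaL L v Γ - differential (modelT E) (energy L) v) η =
      hessL L v η (0, Γ.1 - vel v) + (gradL L v (η.1, 0) - hessL L v Γ (0, η.1)) := by
  refine (congrArg₂ (· - ·) (omegaL_apply hL v Γ η) (differential_energy_apply hL v η)).trans ?_
  have h : ((0, Γ.1 - vel v) : E × E) = (0, Γ.1) - (0, vel v) := by simp
  rw [h, map_sub]
  ring

/-- The second-order condition kills the only term that sees the fibre part of the test vector. What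
is left are Lagrange's equations with Chetaev's reaction forces. -/
theorem nonholonomicAt_iff (hL : ContMDiff (modelT E) 𝓘(ℝ, ℝ) ∞ L)
    {v : TangentBundle 𝓘(ℝ, E) Q} {Γ : E × E} (hΓ : Γ.1 = vel v) :
    NonholonomicAt L M v Γ ↔ Γ ∈ tangentTo (modelT E) M v ∧
      ∃ α ∈ conormal (modelT E) M v, ∀ a : E,
        gradL L v (a, 0) - dcoordLeg L v Γ a = α ((0, a) : E × E) := by
  have key := nonholonomic_form_apply hL v Γ
  have h0 : ((0, Γ.1 - vel v) : E × E) = 0 := by simp [hΓ]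
  constructor
  · rintro ⟨⟨α, hα, h⟩, hT⟩
    refine ⟨hT, α, hα, fun a => ?_⟩
    have h1 := key (a, 0)
    rw [← h] at h1
    have h2 := (vertEndoDual_apply v α (a, 0)).symm.trans h1
    rw [h0, map_zero, zero_add] at h2
    exact h2.symm
  · rintro ⟨hT, α, hα, h⟩
    refine ⟨⟨α, hα, ContinuousLinearMap.ext fun (η : E × E) => ?_⟩, hT⟩
    refine (vertEndoDual_apply v α η).trans (Eq.trans ?_ (key η).symm)
    rw [h0, map_zero, zero_add]
    exact (h η.1).symm

theorem regularAt_iff (hL : ContMDiff (modelT E) 𝓘(ℝ, ℝ) ∞ L)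
    (v : TangentBundle 𝓘(ℝ, E) Q) :
    RegularAt L v ↔ Function.Injective fun a : E => dcoordLeg L v (0, a) := by
  let F : E → (E →L[ℝ] ℝ) := fun u => leg L (⟨v.proj, u⟩ : TangentBundle 𝓘(ℝ, E) Q)
  have h1 : F = fun u => coordLeg L v (extChartAt 𝓘(ℝ, E) v.proj v.proj, u) := by
    funext u
    refine ContinuousLinearMap.ext fun (a : E) => ?_
    have h := leg_frame hL v (mem_extChartAt_target v.proj) u
      (v' := ⟨v.proj, u⟩) ((tangent_mk_eq v.proj (vel v) u).trans
        (extChartAt_tangent_symm v (mem_extChartAt_target v.proj) u)) a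
    exact (congrArg (leg L (⟨v.proj, u⟩ : TangentBundle 𝓘(ℝ, E) Q))
      (frame_self v.proj a).symm).trans h
  have h2 : HasFDerivAt (fun u : E => coordLeg L v (extChartAt 𝓘(ℝ, E) v.proj v.proj, u))
      (dcoordLeg L v ∘L ContinuousLinearMap.inr ℝ E E) (vel v) := by
    have h := hasFDerivAt_coordLeg hL v
    rw [extChartAt_tangent_self] at h
    exact h.comp (vel v) (hasFDerivAt_prodMk_right _ (vel v))
  rw [← h1] at h2
  have h3 : RegularAt L v ↔ Function.Injective (fderiv ℝ F (vel v)) := Iff.rfl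
  rw [h3, h2.fderiv]
  rfl

/-- Forces vanish on vertical vectors, so testing on `(0, b)` leaves D²L((0, b), (0, Γ_q - v)) = 0
for all `b`. By symmetry of D²L the fibre Hessian kills Γ_q - v. -/
theorem isSecondOrderAt_of_regularAt (hL : ContMDiff (modelT E) 𝓘(ℝ, ℝ) ∞ L)
    {v : TangentBundle 𝓘(ℝ, E) Q} (hr : RegularAt L v) {Γ : TangentSpace (modelT E) v}
    (hΓ : NonholonomicAt L M v Γ) : IsSecondOrderAt v Γ := by
  let Γ' : E × E := Γ
  have hΓ' : NonholonomicAt L M v Γ' := hΓ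
  refine (isSecondOrderAt_iff v Γ').2 ?_
  obtain ⟨⟨α, -, h⟩, -⟩ := hΓ'
  have h1 : dcoordLeg L v (0, Γ'.1 - vel v) = dcoordLeg L v (0, 0) := by
    refine ContinuousLinearMap.ext fun b => ?_
    have h2 := nonholonomic_form_apply hL v Γ' (0, b)
    rw [← h] at h2
    have h3 := (vertEndoDual_apply v α (0, b)).symm.trans h2
    have h4 : α ((0, 0) : E × E) = 0 := map_zero α
    rw [h4] at h3
    have h5 : ((0, 0) : E × E) = 0 := rfl
    simp only [h5, map_zero, sub_zero, add_zero] at h3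
    rw [dcoordLeg_apply, dcoordLeg_apply, hessL_comm hL, ← h3, h5]
    simp
  exact sub_eq_zero.1 ((regularAt_iff hL v).1 hr h1)

/-- The test vector has three independent components: the velocity direction yields the Legendre
relation, the momentum direction the second-order condition, and the base direction the dynamical
equation with reaction force. -/
theorem skinnerRuskFormAt_iff (hL : ContMDiff (modelT E) 𝓘(ℝ, ℝ) ∞ L)
    (w : WhitneySum E Q) (X : E × ((E →L[ℝ] ℝ) × E)) :
    SkinnerRuskFormAt L M w X ↔ w.snd.1 = leg L (pr₂ w) ∧ X.1 = vel (pr₂ w) ∧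
      ∃ α ∈ conormal (modelT E) M (pr₂ w), ∀ a : E,
        gradL L (pr₂ w) (a, 0) - X.2.1 a = α ((0, a) : E × E) := by
  have key : ∀ η : E × ((E →L[ℝ] ℝ) × E),
      (contractΩ w X - differential (modelW E) (hamiltonian L) w) η =
        η.2.1 X.1 - X.2.1 η.1 - (η.2.1 (vel (pr₂ w)) + mom (pr₁ w) η.2.2 -
          gradL L (pr₂ w) (η.1, η.2.2)) := fun η =>
    congrArg₂ (· - ·) (contractΩ_apply w X η) (differential_hamiltonian_apply hL w η)
  have keyα : ∀ (α : TangentSpace (modelT E) (pr₂ w) →L[ℝ] ℝ) (η : E × ((E →L[ℝ] ℝ) × E)),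
      (vertEndoDual (pr₂ w) α ∘L mfderiv (modelW E) (modelT E) pr₂ w) η =
        α ((0, η.1) : E × E) := fun α η =>
    (congrArg (vertEndoDual (pr₂ w) α) (mfderiv_pr₂_apply w η)).trans
      (vertEndoDual_apply (pr₂ w) α (η.1, η.2.2))
  constructor
  · rintro ⟨_, ⟨α, hα, rfl⟩, h⟩
    have h1 : ∀ η : E × ((E →L[ℝ] ℝ) × E), α ((0, η.1) : E × E) =
        η.2.1 X.1 - X.2.1 η.1 - (η.2.1 (vel (pr₂ w)) + mom (pr₁ w) η.2.2 -
          gradL L (pr₂ w) (η.1, η.2.2)) := fun η => by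
      rw [← keyα, ← key, h]
    have h00 : α ((0, 0) : E × E) = 0 := map_zero α
    have h00' : gradL L (pr₂ w) ((0, 0) : E × E) = 0 := map_zero _
    refine ⟨?_, ?_, α, hα, fun a => ?_⟩
    · refine ContinuousLinearMap.ext fun (a : E) => ?_
      have h2 := h1 (0, (0, a))
      simp only [h00, map_zero, zero_apply] at h2
      have h3 : mom (pr₁ w) a = gradL L (pr₂ w) (0, a) := by linarith
      exact h3.trans (leg_apply hL (pr₂ w) a).symm
    · refine (SeparatingDual.eq_iff_forall_dual_eq (R := ℝ) (V := E)).2 fun c => ?_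
      have h2 := h1 (0, (c, 0))
      simp only [h00, h00', map_zero] at h2
      linarith
    · have h2 := h1 (a, (0, 0))
      simp only [map_zero, zero_apply] at h2
      linarith
  · rintro ⟨hp, hX, α, hα, h⟩
    refine ⟨_, ⟨α, hα, rfl⟩, ContinuousLinearMap.ext fun (η : E × ((E →L[ℝ] ℝ) × E)) => ?_⟩
    refine (key η).trans (Eq.trans ?_ (keyα α η).symm)
    have h4 : mom (pr₁ w) η.2.2 = gradL L (pr₂ w) (0, η.2.2) :=
      (congrArg (fun p : E →L[ℝ] ℝ => p η.2.2) hp).trans (leg_apply hL (pr₂ w) η.2.2)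
    have h5 : ((η.1, η.2.2) : E × E) = (η.1, 0) + (0, η.2.2) := by simp
    rw [← h, hX, h4, h5, map_add]
    ring

end Equations

/-! ### Tangency transported by coordinate differentials. -/

section Tangency

variable {V : Type*} [NormedAddCommGroup V] [NormedSpace ℝ V]
  {H : Type*} [TopologicalSpace H] {I : ModelWithCorners ℝ V H}
  {N : Type*} [TopologicalSpace N] [ChartedSpace H N]
  {V' : Type*} [NormedAddCommGroup V'] [NormedSpace ℝ V']
  {H' : Type*} [TopologicalSpace H'] {I' : ModelWithCorners ℝ V' H'}
  {N' : Type*} [TopologicalSpace N'] [ChartedSpace H' N']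

theorem mem_tangentTo_of_hasMFDerivAt {F : N → N'} {S : Set N} {S' : Set N'} {U : Set N} {x : N}
    {y : N'} {D : V →L[ℝ] V'} (hD : HasMFDerivAt I I' F x D) (hy : F x = y)
    (hU : IsOpen U) (hx : x ∈ U) (hF : ContMDiffOn I I' ∞ F U) (hS : ∀ y ∈ S ∩ U, F y ∈ S')
    {ξ : V} (hξ : ξ ∈ tangentTo I S x) : D ξ ∈ tangentTo I' S' y := by
  subst hy
  have h := mfderiv_mem_tangentTo hU hx hF hS hξ
  rw [hD.mfderiv] at h
  exact h

theorem hasMFDerivAt_extChartAt_symm_self [I.Boundaryless] [IsManifold I 1 N] {x : N} {z : V}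
    (hz : z = extChartAt I x x) :
    HasMFDerivAt 𝓘(ℝ, V) I (extChartAt I x).symm z (ContinuousLinearMap.id ℝ V) := by
  subst hz
  have h1 := mdifferentiableWithinAt_extChartAt_symm (mem_extChartAt_target (I := I) x)
  rw [ModelWithCorners.range_eq_univ, mdifferentiableWithinAt_univ] at h1
  have h2 := h1.hasMFDerivAt
  have h3 := mfderivWithin_range_extChartAt_symm (I := I) (x := x)
  rw [ModelWithCorners.range_eq_univ, mfderivWithin_univ] at h3
  rw [h3] at h2
  exact h2

theorem hasMFDerivAt_extChartAt_self [IsManifold I 1 N] (x : N) :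
    HasMFDerivAt I 𝓘(ℝ, V) (extChartAt I x) x (ContinuousLinearMap.id ℝ V) := by
  have := (mdifferentiableAt_extChartAt (I := I) (mem_chart_source H x)).hasMFDerivAt
  rwa [mfderiv_extChartAt_self] at this

end Tangency

/-! ### Tangent spaces of the constraint sets and the pointwise equivalence. -/

section Constraints

variable {E : Type*} [NormedAddCommGroup E] [NormedSpace ℝ E]
  {Q : Type*} [TopologicalSpace Q] [ChartedSpace E Q] [IsManifold 𝓘(ℝ, E) ∞ Q]
  {L : TangentBundle 𝓘(ℝ, E) Q → ℝ} {M : Set (TangentBundle 𝓘(ℝ, E) Q)}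

theorem pr₂_extChartAt_symm (w : WhitneySum E Q) {z : E × ((E →L[ℝ] ℝ) × E)}
    (hz : z.1 ∈ (extChartAt 𝓘(ℝ, E) w.proj).target) :
    pr₂ ((extChartAt (modelW E) w).symm z) =
      (extChartAt (modelT E) (pr₂ w)).symm (z.1, z.2.2) := by
  rw [extChartAt_whitney_symm w hz z.2.1 z.2.2]
  exact (extChartAt_tangent_symm (pr₂ w) hz z.2.2).symm

theorem mem_tangentTo_W₀_iff {w : WhitneySum E Q} (hw : pr₂ w ∈ M)
    (X : E × ((E →L[ℝ] ℝ) × E)) :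
    X ∈ tangentTo (modelW E) (W₀ M) w ↔
      ((X.1, X.2.2) : E × E) ∈ tangentTo (modelT E) M (pr₂ w) := by
  constructor
  · intro hX
    exact mem_tangentTo_of_hasMFDerivAt (hasMFDerivAt_pr₂ w) rfl isOpen_univ (mem_univ w)
      contMDiff_pr₂.contMDiffOn (fun y hy => hy.1) hX
  · intro hX
    set ψ := extChartAt (modelT E) (pr₂ w) with hψ
    set χ := extChartAt (modelW E) w with hχ
    have hχw : χ w = ((ψ (pr₂ w)).1, (mom (pr₁ w), (ψ (pr₂ w)).2)) := by
      rw [hχ, hψ, extChartAt_whitney_self, extChartAt_tangent_self]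
      rfl
    have htarget : ∀ z : E × ((E →L[ℝ] ℝ) × E), z ∈ χ.target ↔
        z.1 ∈ (extChartAt 𝓘(ℝ, E) w.proj).target := by
      intro z
      rw [hχ, extChartAt_whitney_target]
      simp
    have hψt : ∀ y ∈ ψ.source, (ψ y).1 ∈ (extChartAt 𝓘(ℝ, E) w.proj).target := by
      intro y hy
      have h := ψ.map_source hy
      rw [hψ, extChartAt_tangent_target] at h
      exact h.1
    have hsource : ψ.source = (chartAt (ModelProd E E) (pr₂ w)).source :=
      extChartAt_source (modelT E) (pr₂ w)
    -- The TQ-part is lifted by a local section of pr₂ with constant momentum coordinate, which maps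
    -- M into pr₂⁻¹(M).
    have hs : ((X.1, (0, X.2.2)) : E × ((E →L[ℝ] ℝ) × E)) ∈ tangentTo (modelW E) (W₀ M) w := by
      let A : E × E → E × ((E →L[ℝ] ℝ) × E) := fun z => (z.1, (mom (pr₁ w), z.2))
      have hA : ContDiff ℝ ∞ A := contDiff_fst.prodMk (contDiff_const.prodMk contDiff_snd)
      have hdA : HasFDerivAt A ((ContinuousLinearMap.fst ℝ E E).prod
          ((0 : E × E →L[ℝ] E →L[ℝ] ℝ).prod (ContinuousLinearMap.snd ℝ E E))) (ψ (pr₂ w)) :=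
        HasFDerivAt.prodMk (hasFDerivAt_fst (𝕜 := ℝ))
          ((hasFDerivAt_const _ _).prodMk (hasFDerivAt_snd (𝕜 := ℝ)))
      have h1 := (hasMFDerivAt_extChartAt_symm_self (I := modelW E) hχw.symm).comp (pr₂ w)
        (hdA.hasMFDerivAt.comp (pr₂ w) (hasMFDerivAt_extChartAt_self (I := modelT E) (pr₂ w)))
      refine mem_tangentTo_of_hasMFDerivAt h1 (U := ψ.source) ?_ ?_ (mem_extChartAt_source _)
        ?_ ?_ hX
      · change χ.symm (A (ψ (pr₂ w))) = w
        have : A (ψ (pr₂ w)) = χ w := hχw.symm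
        rw [this]
        exact extChartAt_to_inv w
      · rw [hsource]
        exact (chartAt _ _).open_source
      · refine (contMDiffOn_extChartAt_symm (n := ∞) w).comp
          (hA.contMDiff.comp_contMDiffOn (by rw [hsource]; exact contMDiffOn_extChartAt)) ?_
        exact fun y hy => (htarget _).2 (hψt y hy)
      · rintro y ⟨hyM, hy⟩
        change pr₂ (χ.symm (A (ψ y))) ∈ M
        rw [hχ, pr₂_extChartAt_symm w (z := A (ψ y)) (hψt y hy)]
        have : ψ.symm (ψ y) ∈ M := by rwa [ψ.left_inv hy]
        exact this
    -- The momentum part is tangent to the fibre of pr₂ through `w`. This fibre lies in pr₂⁻¹(M), so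
    -- the source of the parametrisation carries no constraint.
    have hv : ((0, (X.2.1, 0)) : E × ((E →L[ℝ] ℝ) × E)) ∈ tangentTo (modelW E) (W₀ M) w := by
      let A : (E →L[ℝ] ℝ) → E × ((E →L[ℝ] ℝ) × E) :=
        fun c => ((ψ (pr₂ w)).1, (c, (ψ (pr₂ w)).2))
      have hA : ContDiff ℝ ∞ A := contDiff_const.prodMk (contDiff_id.prodMk contDiff_const)
      have hdA : HasFDerivAt A ((0 : (E →L[ℝ] ℝ) →L[ℝ] E).prod
          ((ContinuousLinearMap.id ℝ (E →L[ℝ] ℝ)).prod (0 : (E →L[ℝ] ℝ) →L[ℝ] E)))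
          (mom (pr₁ w)) :=
        HasFDerivAt.prodMk (hasFDerivAt_const _ _)
          ((hasFDerivAt_id _).prodMk (hasFDerivAt_const _ _))
      have h1 := (hasMFDerivAt_extChartAt_symm_self (I := modelW E) hχw.symm).comp (mom (pr₁ w))
        hdA.hasMFDerivAt
      refine mem_tangentTo_of_hasMFDerivAt h1 (S := univ) ?_ isOpen_univ (mem_univ _)
        ?_ ?_ (ξ := X.2.1) (mem_tangentTo_univ _)
      · change χ.symm (A (mom (pr₁ w))) = w
        have : A (mom (pr₁ w)) = χ w := hχw.symm
        rw [this]
        exact extChartAt_to_inv w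
      · refine (contMDiffOn_extChartAt_symm (n := ∞) w).comp hA.contMDiff.contMDiffOn ?_
        exact fun y hy => (htarget _).2 (hψt _ (mem_extChartAt_source _))
      · rintro c -
        change pr₂ (χ.symm (A c)) ∈ M
        rw [hχ, pr₂_extChartAt_symm w (z := A c) (hψt _ (mem_extChartAt_source _))]
        have : ψ.symm (ψ (pr₂ w)) ∈ M := by rwa [ψ.left_inv (mem_extChartAt_source _)]
        exact this
    have hX2 : X = (X.1, (0, X.2.2)) + (0, (X.2.1, 0)) := by simp
    rw [hX2]
    exact Submodule.add_mem _ hs hv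

/-- Rank–nullity: admissibility in this form says that S* is injective on the annihilator. -/
theorem eq_zero_of_finrank_map_eq {W W' : Type*} [AddCommGroup W] [Module ℝ W]
    [FiniteDimensional ℝ W] [AddCommGroup W'] [Module ℝ W'] (f : W →ₗ[ℝ] W') (p : Submodule ℝ W)
    (h : Module.finrank ℝ p = Module.finrank ℝ (p.map f)) :
    ∀ α ∈ p, f α = 0 → α = 0 := by
  have h2 := (f.domRestrict p).finrank_range_add_finrank_ker
  rw [LinearMap.range_domRestrict] at h2
  have h4 : Module.finrank ℝ (f.domRestrict p).ker = 0 := by omega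
  rw [Submodule.finrank_eq_zero] at h4
  intro α hα h
  have h5 : (⟨α, hα⟩ : p) ∈ (f.domRestrict p).ker := h
  rw [h4, Submodule.mem_bot] at h5
  exact congrArg Subtype.val h5

/-- If T_vM did not project onto T_qQ, a nonzero functional `f` on T_qQ would vanish on the image.
Then `f ∘ Tτ` would be a nonzero conormal covector killed by S*, since S takes vertical values;
admissibility excludes this. -/
theorem exists_mem_tangentTo_of_admissible [FiniteDimensional ℝ E] (hadm : Admissible M)
    {v : TangentBundle 𝓘(ℝ, E) Q} (hv : v ∈ M) (a : E) :
    ∃ Γ : E × E, Γ ∈ tangentTo (modelT E) M v ∧ Γ.1 = a := by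
  have hinj : ∀ α ∈ conormal (modelT E) M v, vertEndoDual v α = 0 → α = 0 := by
    let f : (E × E →L[ℝ] ℝ) →ₗ[ℝ] (E × E →L[ℝ] ℝ) := vertEndoDual v
    let p : Submodule ℝ (E × E →L[ℝ] ℝ) := conormal (modelT E) M v
    exact eq_zero_of_finrank_map_eq f p (hadm v hv)
  let T : Submodule ℝ (E × E) := tangentTo (modelT E) M v
  have htop : T.map (LinearMap.fst ℝ E E) = ⊤ := by
    by_contra hne
    obtain ⟨f, hf0, hf⟩ := Submodule.exists_le_ker_of_lt_top _ (lt_top_iff_ne_top.2 hne)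
    let α : E × E →L[ℝ] ℝ := LinearMap.toContinuousLinearMap (f ∘ₗ LinearMap.fst ℝ E E)
    have hα : α ∈ conormal (modelT E) M v := fun ξ hξ =>
      hf (Submodule.mem_map_of_mem (f := LinearMap.fst ℝ E E) (p := T) hξ)
    have h0 : vertEndoDual v α = 0 := by
      refine ContinuousLinearMap.ext fun (η : E × E) => ?_
      exact (vertEndoDual_apply v α η).trans (map_zero f)
    have h1 : α = 0 := hinj α hα h0
    refine hf0 (LinearMap.ext fun b => ?_)
    exact congrArg (fun β : E × E →L[ℝ] ℝ => β (b, 0)) h1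
  obtain ⟨Γ, hΓ, h⟩ : a ∈ T.map (LinearMap.fst ℝ E E) := htop ▸ Submodule.mem_top
  exact ⟨Γ, hΓ, h⟩

theorem eq_legGraph_of_snd_eq {w : WhitneySum E Q} (h : w.snd.1 = leg L (pr₂ w)) :
    w = legGraph L (pr₂ w) := by
  obtain ⟨q, p, u⟩ := w
  exact congrArg (fun p' => (⟨q, (p', u)⟩ : WhitneySum E Q)) h

theorem legGraph_mem_Mtilde {v : TangentBundle 𝓘(ℝ, E) Q} (hv : v ∈ M) :
    legGraph L v ∈ Mtilde L M := ⟨hv, rfl⟩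

theorem eq_legGraph_of_mem_Mtilde {w : WhitneySum E Q} (hw : w ∈ Mtilde L M) :
    w = legGraph L (pr₂ w) := eq_legGraph_of_snd_eq hw.2

theorem dlegGraph_mem_tangentTo (hL : ContMDiff (modelT E) 𝓘(ℝ, ℝ) ∞ L)
    {v : TangentBundle 𝓘(ℝ, E) Q} {Γ : TangentSpace (modelT E) v}
    (hΓ : Γ ∈ tangentTo (modelT E) M v) :
    dlegGraph L v Γ ∈ tangentTo (modelW E) (Mtilde L M) (legGraph L v) :=
  mfderiv_mem_tangentTo isOpen_univ (mem_univ v) (contMDiff_legGraph hL).contMDiffOn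
    (fun _ hy => legGraph_mem_Mtilde hy.1) hΓ

theorem mfderiv_pr₂_mem_tangentTo {w : WhitneySum E Q} {X : TangentSpace (modelW E) w}
    (hX : X ∈ tangentTo (modelW E) (Mtilde L M) w) :
    mfderiv (modelW E) (modelT E) pr₂ w X ∈ tangentTo (modelT E) M (pr₂ w) :=
  mfderiv_mem_tangentTo isOpen_univ (mem_univ w) contMDiff_pr₂.contMDiffOn
    (fun _ hy => hy.1.1) hX

theorem mfderiv_pr₂_dlegGraph (hL : ContMDiff (modelT E) 𝓘(ℝ, ℝ) ∞ L)
    (v : TangentBundle 𝓘(ℝ, E) Q) (Γ : TangentSpace (modelT E) v) :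
    mfderiv (modelW E) (modelT E) pr₂ (legGraph L v) (dlegGraph L v Γ) = Γ :=
  (congrArg (mfderiv (modelW E) (modelT E) pr₂ (legGraph L v)) (dlegGraph_apply hL v Γ)).trans
    (mfderiv_pr₂_apply (legGraph L v) _)

/-- The map g ∘ pr₂ is the identity on M̃, so its differential fixes the vectors tangent to M̃. -/
theorem dlegGraph_mfderiv_pr₂ (hL : ContMDiff (modelT E) 𝓘(ℝ, ℝ) ∞ L)
    {v : TangentBundle 𝓘(ℝ, E) Q} (hv : v ∈ M) {X : TangentSpace (modelW E) (legGraph L v)}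
    (hX : X ∈ tangentTo (modelW E) (Mtilde L M) (legGraph L v)) :
    dlegGraph L v (mfderiv (modelW E) (modelT E) pr₂ (legGraph L v) X) = X := by
  have h1 := mfderiv_eq_self_of_mem_tangentTo (F := legGraph L ∘ pr₂) isOpen_univ (mem_univ _)
    (legGraph_mem_Mtilde hv) ((contMDiff_legGraph hL).comp contMDiff_pr₂).contMDiffOn
    (fun y hy => (eq_legGraph_of_mem_Mtilde hy.1).symm) hX
  rw [((hasMFDerivAt_legGraph hL v).comp (legGraph L v)
    (hasMFDerivAt_pr₂ (legGraph L v))).mfderiv] at h1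
  refine Eq.trans ?_ h1
  exact (congrArg (dlegGraph L v) (mfderiv_pr₂_apply (legGraph L v) X)).trans
    (dlegGraph_apply hL v _)

/-- The momentum component of `dlegGraphCoord` is the derivative of ∂L/∂q̇ along `Γ`, which makes
the two coordinate systems literally the same. The point `w` is not replaced by `legGraph`, so that
the result applies directly along curves. -/
theorem skinnerRuskAt_iff (hL : ContMDiff (modelT E) 𝓘(ℝ, ℝ) ∞ L) {w : WhitneySum E Q}
    (hw : w.snd.1 = leg L (pr₂ w)) (hM : pr₂ w ∈ M) (Γ : E × E) :
    SkinnerRuskAt L M w (dlegGraphCoord L (pr₂ w) Γ) ↔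
      NonholonomicAt L M (pr₂ w) Γ ∧ IsSecondOrderAt (pr₂ w) Γ := by
  have h1 := skinnerRuskFormAt_iff (M := M) hL w (dlegGraphCoord L (pr₂ w) Γ)
  have h2 := mem_tangentTo_W₀_iff hM (dlegGraphCoord L (pr₂ w) Γ)
  have h3 := isSecondOrderAt_iff (pr₂ w) Γ
  constructor
  · rintro ⟨hf, ht⟩
    obtain ⟨-, hΓ, hα⟩ := h1.1 hf
    exact ⟨(nonholonomicAt_iff hL hΓ).2 ⟨h2.1 ht, hα⟩, h3.2 hΓ⟩
  · rintro ⟨hn, hs⟩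
    have hΓ := h3.1 hs
    obtain ⟨ht, hα⟩ := (nonholonomicAt_iff hL hΓ).1 hn
    exact ⟨h1.2 ⟨hw, hΓ, hα⟩, h2.2 ht⟩

theorem skinnerRuskAt_dlegGraph_iff (hL : ContMDiff (modelT E) 𝓘(ℝ, ℝ) ∞ L)
    {v : TangentBundle 𝓘(ℝ, E) Q} (hv : v ∈ M) (Γ : TangentSpace (modelT E) v) :
    SkinnerRuskAt L M (legGraph L v) (dlegGraph L v Γ) ↔
      NonholonomicAt L M v Γ ∧ IsSecondOrderAt v Γ := by
  rw [dlegGraph_apply hL v Γ]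
  exact skinnerRuskAt_iff (w := legGraph L v) hL rfl hv Γ

end Constraints

/-! ### M̃ as an embedded submanifold. -/

section Submanifold

theorem mfderiv_apply_of_comp {V V' V'' : Type*} [NormedAddCommGroup V] [NormedSpace ℝ V]
    {H : Type*} [TopologicalSpace H] {I : ModelWithCorners ℝ V H}
    {N : Type*} [TopologicalSpace N] [ChartedSpace H N]
    [NormedAddCommGroup V'] [NormedSpace ℝ V']
    {H' : Type*} [TopologicalSpace H'] {I' : ModelWithCorners ℝ V' H'}
    {N' : Type*} [TopologicalSpace N'] [ChartedSpace H' N']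
    [NormedAddCommGroup V''] [NormedSpace ℝ V'']
    {F : N → V''} {τ : N' → N} {x : N'} {y : N} {T : V' →L[ℝ] V} {D : V' →L[ℝ] V''}
    (hF : MDifferentiableAt I 𝓘(ℝ, V'') F y) (hτ : HasMFDerivAt I' I τ x T) (hy : τ x = y)
    (hD : HasMFDerivAt I' 𝓘(ℝ, V'') (F ∘ τ) x D) (ξ : V') :
    mfderiv I 𝓘(ℝ, V'') F y (T ξ) = D ξ := by
  subst hy
  have h := hasMFDerivAt_unique (hF.hasMFDerivAt.comp x hτ) hD
  exact congrArg (fun A : V' →L[ℝ] V'' => A ξ) h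

variable {E : Type*} [NormedAddCommGroup E] [NormedSpace ℝ E]
  {Q : Type*} [TopologicalSpace Q] [ChartedSpace E Q] [IsManifold 𝓘(ℝ, E) ∞ Q]
  {L : TangentBundle 𝓘(ℝ, E) Q → ℝ} {M : Set (TangentBundle 𝓘(ℝ, E) Q)}

/-- The function `p - ∂L/∂q̇`, in the preferred chart at `w`. -/
def legDefect (L : TangentBundle 𝓘(ℝ, E) Q → ℝ) (w y : WhitneySum E Q) : E →L[ℝ] ℝ :=
  (extChartAt (modelW E) w y).2.1 - coordLeg L (pr₂ w)
    ((extChartAt (modelW E) w y).1, (extChartAt (modelW E) w y).2.2)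

theorem extChartAt_whitney_mem {w y : WhitneySum E Q}
    (hy : y ∈ (chartAt (ModelProd E ((E →L[ℝ] ℝ) × E)) w).source) :
    (extChartAt (modelW E) w y).1 ∈ (extChartAt 𝓘(ℝ, E) w.proj).target := by
  rw [← extChartAt_source (modelW E)] at hy
  have h := (extChartAt (modelW E) w).map_source hy
  rw [extChartAt_whitney_target] at h
  exact h.1

/-- Both covectors are their coordinates composed with the same coframe, which is invertible on the
chart domain; hence they agree exactly when their coordinates do. -/
theorem legDefect_eq_zero_iff (hL : ContMDiff (modelT E) 𝓘(ℝ, ℝ) ∞ L) {w y : WhitneySum E Q}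
    (hy : y ∈ (chartAt (ModelProd E ((E →L[ℝ] ℝ) × E)) w).source) :
    legDefect L w y = 0 ↔ y.snd.1 = leg L (pr₂ y) := by
  have hx := extChartAt_whitney_mem hy
  rw [← extChartAt_source (modelW E)] at hy
  unfold legDefect
  generalize hz : extChartAt (modelW E) w y = z at hx
  have hyz := (extChartAt (modelW E) w).left_inv hy
  rw [hz, extChartAt_whitney_symm w hx z.2.1 z.2.2] at hyz
  subst hyz
  have h1 := leg_eq_comp_coframe hL (pr₂ w) hx z.2.2
  rw [sub_eq_zero]
  constructor
  · intro h
    refine Eq.trans ?_ h1.symm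
    rw [h]
    rfl
  · intro h
    have h2 := h.trans h1
    refine ContinuousLinearMap.ext fun a => ?_
    have h3 := congrArg (fun p : TangentSpace 𝓘(ℝ, E) ((extChartAt 𝓘(ℝ, E) w.proj).symm z.1)
      →L[ℝ] ℝ => p (frame w.proj _ a)) h2
    have h4 := coframe_frame ((extChartAt 𝓘(ℝ, E) w.proj).map_target hx) a
    exact (congrArg z.2.1 h4).symm.trans (h3.trans
      (congrArg (coordLeg L (pr₂ w) (z.1, z.2.2)) h4))

theorem contMDiffOn_legDefect (hL : ContMDiff (modelT E) 𝓘(ℝ, ℝ) ∞ L) (w : WhitneySum E Q) :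
    ContMDiffOn (modelW E) 𝓘(ℝ, E →L[ℝ] ℝ) ∞ (legDefect L w)
      (chartAt (ModelProd E ((E →L[ℝ] ℝ) × E)) w).source := by
  intro y hy
  have h1 := (contMDiffOn_extChartAt (I := modelW E) (n := ∞) (x := w)) y hy
  have h2 : ContDiffAt ℝ ∞ (fun z : E × ((E →L[ℝ] ℝ) × E) =>
      z.2.1 - coordLeg L (pr₂ w) (z.1, z.2.2)) (extChartAt (modelW E) w y) :=
    (contDiff_snd.fst.contDiffAt).sub
      (ContDiffAt.comp (g := coordLeg L (pr₂ w)) (f := fun z : E × ((E →L[ℝ] ℝ) × E) =>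
        (z.1, z.2.2)) _ (contDiffAt_coordLeg hL (pr₂ w) (extChartAt_whitney_mem hy))
        (contDiff_fst.prodMk contDiff_snd.snd).contDiffAt)
  exact h2.contMDiffAt.comp_contMDiffWithinAt y h1

/-- The differential is block triangular: along the graph of Leg_L the first component stays zero
while `Φ` covers the second factor, and along the momentum fibre the second component is constant
while the first varies as the identity. -/
theorem exists_mfderiv_legDefect_prod_eq (hL : ContMDiff (modelT E) 𝓘(ℝ, ℝ) ∞ L)
    {k : ℕ} {w : WhitneySum E Q} {v : TangentBundle 𝓘(ℝ, E) Q}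
    (hv : legGraph L v ∈ (chartAt (ModelProd E ((E →L[ℝ] ℝ) × E)) w).source)
    {Φ : TangentBundle 𝓘(ℝ, E) Q → EuclideanSpace ℝ (Fin k)}
    (hΦ : MDifferentiableAt (modelT E) 𝓘(ℝ, EuclideanSpace ℝ (Fin k)) Φ v)
    (hs : Function.Surjective (mfderiv (modelT E) 𝓘(ℝ, EuclideanSpace ℝ (Fin k)) Φ v))
    (b : (E →L[ℝ] ℝ) × EuclideanSpace ℝ (Fin k)) :
    ∃ X, mfderiv (modelW E) 𝓘(ℝ, (E →L[ℝ] ℝ) × EuclideanSpace ℝ (Fin k))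
      (fun y => (legDefect L w y, Φ (pr₂ y))) (legGraph L v) X = b := by
  set F : WhitneySum E Q → (E →L[ℝ] ℝ) × EuclideanSpace ℝ (Fin k) :=
    fun y => (legDefect L w y, Φ (pr₂ y)) with hF_def
  have hopen := (chartAt (ModelProd E ((E →L[ℝ] ℝ) × E)) w).open_source
  have hF : MDifferentiableAt (modelW E) 𝓘(ℝ, (E →L[ℝ] ℝ) × EuclideanSpace ℝ (Fin k)) F
      (legGraph L v) := by
    refine MDifferentiableAt.prodMk_space
      ((contMDiffOn_legDefect hL w).contMDiffAt (hopen.mem_nhds hv) |>.mdifferentiableAt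
        (by simp)) ?_
    exact MDifferentiableAt.comp (legGraph L v) (f := pr₂) (g := Φ) hΦ
      (hasMFDerivAt_pr₂ _).mdifferentiableAt
  obtain ⟨Γ, hΓ⟩ := hs b.2
  let DΦ : E × E →L[ℝ] EuclideanSpace ℝ (Fin k) :=
    mfderiv (modelT E) 𝓘(ℝ, EuclideanSpace ℝ (Fin k)) Φ v
  have h1 : HasMFDerivAt (modelT E) 𝓘(ℝ, (E →L[ℝ] ℝ) × EuclideanSpace ℝ (Fin k))
      (F ∘ legGraph L) v ((0 : E × E →L[ℝ] E →L[ℝ] ℝ).prod DΦ) := by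
    refine HasMFDerivAt.congr_of_eventuallyEq (f := fun v' => ((0 : E →L[ℝ] ℝ), Φ v')) ?_ ?_
    · have h0 := hasMFDerivAt_const (I := modelT E) (I' := 𝓘(ℝ, E →L[ℝ] ℝ)) (0 : E →L[ℝ] ℝ) v
      exact ⟨h0.1.prodMk hΦ.hasMFDerivAt.1, HasFDerivWithinAt.prodMk h0.2 hΦ.hasMFDerivAt.2⟩
    · have hc := (contMDiff_legGraph hL).continuous.continuousAt (x := v)
      filter_upwards [hc.preimage_mem_nhds (hopen.mem_nhds hv)] with v' hv'
      exact Prod.ext ((legDefect_eq_zero_iff hL hv').2 rfl) rfl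
  have h1' := mfderiv_apply_of_comp hF (hasMFDerivAt_legGraph hL v) rfl h1 Γ
  set χ := extChartAt (modelW E) w with hχ
  set y := legGraph L v with hy_def
  let A : (E →L[ℝ] ℝ) → E × ((E →L[ℝ] ℝ) × E) := fun c => ((χ y).1, (c, (χ y).2.2))
  have hAt : ∀ c, A c ∈ χ.target := by
    intro c
    rw [hχ, extChartAt_whitney_target]
    exact ⟨extChartAt_whitney_mem hv, mem_univ _⟩
  have hyχ : y ∈ χ.source := by rw [hχ, extChartAt_source]; exact hv
  have hτ : MDifferentiableAt 𝓘(ℝ, E →L[ℝ] ℝ) (modelW E) (χ.symm ∘ A) (χ y).2.1 := by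
    have hA : ContDiff ℝ ∞ A := contDiff_const.prodMk (contDiff_id.prodMk contDiff_const)
    have h := (contMDiffOn_extChartAt_symm (I := modelW E) (n := ∞) w).comp
      hA.contMDiff.contMDiffOn (s := univ) (fun c _ => hAt c)
    exact ((contMDiffOn_univ.1 h) _).mdifferentiableAt (by simp)
  have hτy : (χ.symm ∘ A) (χ y).2.1 = y := χ.left_inv hyχ
  have h2 : HasMFDerivAt 𝓘(ℝ, E →L[ℝ] ℝ) 𝓘(ℝ, (E →L[ℝ] ℝ) × EuclideanSpace ℝ (Fin k))
      (F ∘ (χ.symm ∘ A)) (χ y).2.1 ((ContinuousLinearMap.id ℝ (E →L[ℝ] ℝ)).prod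
        (0 : (E →L[ℝ] ℝ) →L[ℝ] EuclideanSpace ℝ (Fin k))) := by
    have h3 : F ∘ (χ.symm ∘ A) = fun c =>
        (c - coordLeg L (pr₂ w) ((χ y).1, (χ y).2.2), Φ (pr₂ y)) := by
      funext c
      refine Prod.ext ?_ ?_
      · change legDefect L w (χ.symm (A c)) = _
        unfold legDefect
        rw [← hχ, χ.right_inv (hAt c)]
      · change Φ (pr₂ (χ.symm (A c))) = Φ (pr₂ y)
        have e1 := pr₂_extChartAt_symm w (z := A c) (extChartAt_whitney_mem hv)
        have e2 := pr₂_extChartAt_symm w (z := χ y) (extChartAt_whitney_mem hv)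
        rw [← hχ] at e1 e2
        rw [χ.left_inv hyχ] at e2
        rw [e1, e2]
    rw [h3]
    exact HasFDerivAt.hasMFDerivAt
      (((hasFDerivAt_id _).sub_const _).prodMk (hasFDerivAt_const _ _))
  let T : (E →L[ℝ] ℝ) →L[ℝ] E × ((E →L[ℝ] ℝ) × E) :=
    mfderiv 𝓘(ℝ, E →L[ℝ] ℝ) (modelW E) (χ.symm ∘ A) (χ y).2.1
  have h2' := mfderiv_apply_of_comp (T := T) hF hτ.hasMFDerivAt hτy h2 b.1
  -- The graph direction supplies `(0, b.2)` and the momentum direction `(b.1, 0)`.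
  refine ⟨dlegGraphCoord L v Γ + T b.1, ?_⟩
  refine (map_add (mfderiv (modelW E) 𝓘(ℝ, (E →L[ℝ] ℝ) × EuclideanSpace ℝ (Fin k)) F y)
    _ _).trans ((congrArg₂ (· + ·) h1' h2').trans ?_)
  have hb : ((0 : E →L[ℝ] ℝ), DΦ Γ) + (b.1, (0 : EuclideanSpace ℝ (Fin k))) = b := by
    have : DΦ Γ = b.2 := hΓ
    simp [this]
  exact hb

theorem isSubmanifold_Mtilde [FiniteDimensional ℝ E] (hL : ContMDiff (modelT E) 𝓘(ℝ, ℝ) ∞ L)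
    {m : ℕ} (hM : IsSubmanifold (modelT E) M m) :
    IsSubmanifold (modelW E) (Mtilde L M) (Module.finrank ℝ E + m) := by
  intro w hw
  obtain ⟨U, hU, hwU, Φ, hΦ, hMU, hs⟩ := hM (pr₂ w) hw.1
  have hdim : Module.finrank ℝ ((E →L[ℝ] ℝ) × EuclideanSpace ℝ (Fin m)) =
      Module.finrank ℝ (EuclideanSpace ℝ (Fin (Module.finrank ℝ E + m))) := by
    rw [Module.finrank_prod, finrank_euclideanSpace_fin, finrank_euclideanSpace_fin,
      ← (LinearMap.toContinuousLinearMap (𝕜 := ℝ) (E := E) (F' := ℝ)).finrank_eq]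
    exact congrArg (· + m) Subspace.dual_finrank_eq
  -- The natural defining map takes values in `(E →L[ℝ] ℝ) × ℝᵐ`; any linear isomorphism carries it
  -- to the Euclidean space demanded by `IsSubmanifold`.
  let e := ContinuousLinearEquiv.ofFinrankEq hdim
  let F : WhitneySum E Q → (E →L[ℝ] ℝ) × EuclideanSpace ℝ (Fin m) :=
    fun y => (legDefect L w y, Φ (pr₂ y))
  have hUopen : IsOpen (pr₂ ⁻¹' U ∩ (chartAt (ModelProd E ((E →L[ℝ] ℝ) × E)) w).source) :=
    (hU.preimage contMDiff_pr₂.continuous).inter (chartAt _ w).open_source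
  have hF : ContMDiffOn (modelW E) 𝓘(ℝ, (E →L[ℝ] ℝ) × EuclideanSpace ℝ (Fin m)) ∞ F
      (pr₂ ⁻¹' U ∩ (chartAt (ModelProd E ((E →L[ℝ] ℝ) × E)) w).source) :=
    ((contMDiffOn_legDefect hL w).mono inter_subset_right).prodMk_space
      (hΦ.comp contMDiff_pr₂.contMDiffOn (fun y hy => hy.1))
  have hzero : ∀ y ∈ pr₂ ⁻¹' U ∩ (chartAt (ModelProd E ((E →L[ℝ] ℝ) × E)) w).source,
      (y ∈ Mtilde L M ↔ F y = 0) := by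
    intro y hy
    have h1 : pr₂ y ∈ M ↔ Φ (pr₂ y) = 0 := by
      have h := Set.ext_iff.1 hMU (pr₂ y)
      constructor
      · exact fun hyM => (h.1 ⟨hyM, hy.1⟩).2
      · exact fun h0 => (h.2 ⟨hy.1, h0⟩).1
    have h2 := legDefect_eq_zero_iff hL hy.2
    have h3 : y ∈ Mtilde L M ↔ pr₂ y ∈ M ∧ y.snd.1 = leg L (pr₂ y) := Iff.rfl
    rw [h3, h1, ← h2, Prod.ext_iff, and_comm]
    rfl
  refine ⟨_, hUopen, ⟨hwU, mem_chart_source _ w⟩, fun y => e (F y), ?_, ?_, ?_⟩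
  · exact e.contDiff.contMDiff.comp_contMDiffOn hF
  · ext y
    constructor
    · rintro ⟨hy, hyU⟩
      exact ⟨hyU, (congrArg e ((hzero y hyU).1 hy)).trans (map_zero e)⟩
    · rintro ⟨hyU, hy⟩
      exact ⟨(hzero y hyU).2 ((map_eq_zero_iff e e.injective).1 hy), hyU⟩
  · rintro y ⟨hy, hyU⟩ b
    have hyg := eq_legGraph_of_mem_Mtilde hy
    have hFy : MDifferentiableAt (modelW E) 𝓘(ℝ, (E →L[ℝ] ℝ) × EuclideanSpace ℝ (Fin m)) F y :=
      (hF.contMDiffAt (hUopen.mem_nhds hyU)).mdifferentiableAt (by simp)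
    have he : HasMFDerivAt 𝓘(ℝ, (E →L[ℝ] ℝ) × EuclideanSpace ℝ (Fin m))
      𝓘(ℝ, EuclideanSpace ℝ (Fin (Module.finrank ℝ E + m))) e (F y)
        e.toContinuousLinearMap := e.hasFDerivAt.hasMFDerivAt
    have hd := (he.comp y hFy.hasMFDerivAt).mfderiv
    have hex : ∃ X, mfderiv (modelW E) 𝓘(ℝ, (E →L[ℝ] ℝ) × EuclideanSpace ℝ (Fin m)) F y X =
        e.symm b := by
      rw [hyg]
      refine exists_mfderiv_legDefect_prod_eq hL (hyg ▸ hyU.2) ?_ (hs _ ⟨hy.1, hyU.1⟩) _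
      exact (hΦ.contMDiffAt (hU.mem_nhds hyU.1)).mdifferentiableAt (by simp)
    obtain ⟨X, hX⟩ := hex
    refine ⟨X, ?_⟩
    have hd2 : mfderiv (modelW E) 𝓘(ℝ, EuclideanSpace ℝ (Fin (Module.finrank ℝ E + m)))
      (fun y => e (F y)) y = _ := hd
    rw [hd2]
    exact (congrArg e hX).trans (e.apply_symm_apply b)

end Submanifold

/-! ### Equivalence for curves. -/

section Trajectories

variable {E : Type*} [NormedAddCommGroup E] [NormedSpace ℝ E]
  {Q : Type*} [TopologicalSpace Q] [ChartedSpace E Q] [IsManifold 𝓘(ℝ, E) ∞ Q]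
  {L : TangentBundle 𝓘(ℝ, E) Q → ℝ} {M : Set (TangentBundle 𝓘(ℝ, E) Q)}

/-- As `J` is open, w = g ∘ v holds near `t` and can be differentiated. -/
theorem velocity_eq_of_eq_legGraph (hL : ContMDiff (modelT E) 𝓘(ℝ, ℝ) ∞ L)
    {J : Set ℝ} (hJ : IsOpen J) {w : ℝ → WhitneySum E Q} {t : ℝ} (ht : t ∈ J)
    (hw : MDifferentiableAt 𝓘(ℝ, ℝ) (modelW E) w t)
    (hg : ∀ s ∈ J, w s = legGraph L (pr₂ (w s))) :
    velocity (modelW E) w t = dlegGraphCoord L (pr₂ (w t))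
      (velocity (modelT E) (fun s => pr₂ (w s)) t : E × E) := by
  have hv : MDifferentiableAt 𝓘(ℝ, ℝ) (modelT E) (fun s => pr₂ (w s)) t :=
    (hasMFDerivAt_pr₂ (w t)).mdifferentiableAt.comp t hw
  have h := (hasMFDerivAt_legGraph hL (pr₂ (w t))).comp t hv.hasMFDerivAt
  have he : w =ᶠ[𝓝 t] legGraph L ∘ fun s => pr₂ (w s) := by
    filter_upwards [hJ.mem_nhds ht] with s hs using hg s hs
  have h2 := (h.congr_of_eventuallyEq he).mfderiv
  unfold velocity
  rw [h2]
  rfl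

theorem trajectory_iff (hL : ContMDiff (modelT E) 𝓘(ℝ, ℝ) ∞ L)
    {J : Set ℝ} (hJ : IsOpen J) {w : ℝ → WhitneySum E Q}
    (hw : ∀ t ∈ J, MDifferentiableAt 𝓘(ℝ, ℝ) (modelW E) w t) :
    (∀ t ∈ J, w t ∈ W₀ M ∧ SkinnerRuskAt L M (w t) (velocity (modelW E) w t)) ↔
      ∀ t ∈ J, w t = legGraph L (pr₂ (w t)) ∧ pr₂ (w t) ∈ M ∧
        NonholonomicAt L M (pr₂ (w t)) (velocity (modelT E) (fun s => pr₂ (w s)) t) ∧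
        IsSecondOrderAt (pr₂ (w t)) (velocity (modelT E) (fun s => pr₂ (w s)) t) := by
  have key : ∀ (hg : ∀ s ∈ J, w s = legGraph L (pr₂ (w s))), ∀ t ∈ J, pr₂ (w t) ∈ M →
      (SkinnerRuskAt L M (w t) (velocity (modelW E) w t) ↔
        NonholonomicAt L M (pr₂ (w t)) (velocity (modelT E) (fun s => pr₂ (w s)) t) ∧
        IsSecondOrderAt (pr₂ (w t)) (velocity (modelT E) (fun s => pr₂ (w s)) t)) := by
    intro hg t ht hM
    have h1 := velocity_eq_of_eq_legGraph hL hJ ht (hw t ht) hg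
    have h2 : (w t).snd.1 = leg L (pr₂ (w t)) := by
      have : (legGraph L (pr₂ (w t))).snd.1 = leg L (pr₂ (legGraph L (pr₂ (w t)))) := rfl
      rwa [← hg t ht] at this
    rw [h1]
    exact skinnerRuskAt_iff hL h2 hM _
  constructor
  · intro h
    -- The equation at each single time already forces the Legendre relation; only with this known
    -- on all of `J` can the velocity be computed.
    have hg : ∀ s ∈ J, w s = legGraph L (pr₂ (w s)) := fun s hs =>
      eq_legGraph_of_snd_eq ((skinnerRuskFormAt_iff hL (w s) _).1 (h s hs).2.1).1
    exact fun t ht => ⟨hg t ht, (h t ht).1, (key hg t ht (h t ht).1).1 (h t ht).2⟩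
  · intro h t ht
    exact ⟨(h t ht).2.1, (key (fun s hs => (h s hs).1) t ht (h t ht).2.1).2 (h t ht).2.2⟩

end Trajectories

/-! ### Solvability, the diffeomorphism, and vector fields related by it. -/

section Fields

variable {E : Type*} [NormedAddCommGroup E] [NormedSpace ℝ E]
  {Q : Type*} [TopologicalSpace Q] [ChartedSpace E Q] [IsManifold 𝓘(ℝ, E) ∞ Q]
  {L : TangentBundle 𝓘(ℝ, E) Q → ℝ} {M : Set (TangentBundle 𝓘(ℝ, E) Q)}

theorem mem_Mtilde_of_skinnerRuskFormAt (hL : ContMDiff (modelT E) 𝓘(ℝ, ℝ) ∞ L)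
    {w : WhitneySum E Q} (hw : w ∈ W₀ M) {X : TangentSpace (modelW E) w}
    (hX : SkinnerRuskFormAt L M w X) : w ∈ Mtilde L M :=
  ⟨hw, ((skinnerRuskFormAt_iff hL w X).1 hX).1⟩

theorem exists_skinnerRuskAt [FiniteDimensional ℝ E] (hL : ContMDiff (modelT E) 𝓘(ℝ, ℝ) ∞ L)
    (hadm : Admissible M) {w : WhitneySum E Q} (hw : w ∈ Mtilde L M) :
    ∃ X, SkinnerRuskAt L M w X := by
  obtain ⟨Γ, hΓ, hΓ1⟩ := exists_mem_tangentTo_of_admissible hadm hw.1 (vel (pr₂ w))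
  -- With zero reaction force the dynamical equation reads X_p = ∂L/∂q. The momentum component is
  -- otherwise free, since tangency is only required to pr₂⁻¹(M) and not to M̃.
  let X : E × ((E →L[ℝ] ℝ) × E) :=
    (Γ.1, (gradL L (pr₂ w) ∘L ContinuousLinearMap.inl ℝ E E, Γ.2))
  refine ⟨X, (skinnerRuskFormAt_iff hL w X).2 ⟨hw.2, hΓ1, 0, Submodule.zero_mem _, fun a => ?_⟩,
    (mem_tangentTo_W₀_iff hw.1 X).2 hΓ⟩
  exact sub_self _

theorem bijOn_dlegGraph (hL : ContMDiff (modelT E) 𝓘(ℝ, ℝ) ∞ L) {v : TangentBundle 𝓘(ℝ, E) Q}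
    (hv : v ∈ M) : BijOn (dlegGraph L v)
      {Γ | NonholonomicAt L M v Γ ∧ IsSecondOrderAt v Γ}
      {X | SkinnerRuskAt L M (legGraph L v) X ∧
        X ∈ tangentTo (modelW E) (Mtilde L M) (legGraph L v)} := by
  refine ⟨fun Γ hΓ => ?_, fun Γ _ Γ' _ h => ?_, fun X hX => ?_⟩
  · exact ⟨(skinnerRuskAt_dlegGraph_iff hL hv Γ).2 hΓ, dlegGraph_mem_tangentTo hL hΓ.1.2⟩
  · have h2 := congrArg (mfderiv (modelW E) (modelT E) pr₂ (legGraph L v)) h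
    rwa [mfderiv_pr₂_dlegGraph hL, mfderiv_pr₂_dlegGraph hL] at h2
  · have h := dlegGraph_mfderiv_pr₂ hL hv hX.2
    refine ⟨_, (skinnerRuskAt_dlegGraph_iff hL hv _).1 ?_, h⟩
    rw [h]
    exact hX.1

theorem isDiffeoBetween_legGraph (hL : ContMDiff (modelT E) 𝓘(ℝ, ℝ) ∞ L) :
    IsDiffeoBetween (modelT E) (modelW E) (legGraph L) pr₂ M (Mtilde L M) where
  mapsTo _ hv := legGraph_mem_Mtilde hv
  mapsTo_inv _ hw := hw.1
  invOn := ⟨fun _ _ => rfl, fun _ hw => (eq_legGraph_of_mem_Mtilde hw).symm⟩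
  smooth := (contMDiff_legGraph hL).contMDiffOn
  smooth_inv := contMDiff_pr₂.contMDiffOn

theorem forall_mem_Mtilde_iff {P : WhitneySum E Q → Prop} :
    (∀ w ∈ Mtilde L M, P w) ↔ ∀ v ∈ M, P (legGraph L v) := by
  refine ⟨fun h v hv => h _ (legGraph_mem_Mtilde hv), fun h w hw => ?_⟩
  rw [eq_legGraph_of_mem_Mtilde hw]
  exact h _ hw.1

variable {Γ : ∀ v : TangentBundle 𝓘(ℝ, E) Q, TangentSpace (modelT E) v}
  {X : ∀ w : WhitneySum E Q, TangentSpace (modelW E) w}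

theorem mfderiv_pr₂_of_related (hL : ContMDiff (modelT E) 𝓘(ℝ, ℝ) ∞ L)
    (hX : ∀ v ∈ M, X (legGraph L v) = dlegGraph L v (Γ v)) {v : TangentBundle 𝓘(ℝ, E) Q}
    (hv : v ∈ M) :
    mfderiv (modelW E) (modelT E) pr₂ (legGraph L v) (X (legGraph L v)) = Γ v := by
  rw [hX v hv, mfderiv_pr₂_dlegGraph hL]

theorem tangent_iff_of_related (hL : ContMDiff (modelT E) 𝓘(ℝ, ℝ) ∞ L)
    (hX : ∀ v ∈ M, X (legGraph L v) = dlegGraph L v (Γ v)) :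
    (∀ v ∈ M, Γ v ∈ tangentTo (modelT E) M v) ↔
      ∀ w ∈ Mtilde L M, X w ∈ tangentTo (modelW E) (Mtilde L M) w := by
  rw [forall_mem_Mtilde_iff]
  refine forall₂_congr fun v hv => ⟨fun h => ?_, fun h => ?_⟩
  · rw [hX v hv]
    exact dlegGraph_mem_tangentTo hL h
  · rw [← mfderiv_pr₂_of_related hL hX hv]
    exact mfderiv_pr₂_mem_tangentTo h

/-- Each field is obtained from the other by composing with smooth maps: X = Tg ∘ Γ ∘ pr₂ on M̃ and
Γ = Tpr₂ ∘ X ∘ g on M. -/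
theorem contMDiffOn_iff_of_related (hL : ContMDiff (modelT E) 𝓘(ℝ, ℝ) ∞ L)
    (hX : ∀ v ∈ M, X (legGraph L v) = dlegGraph L v (Γ v)) :
    ContMDiffOn (modelT E) (modelT E).tangent ∞
        (fun v => (⟨v, Γ v⟩ : TangentBundle (modelT E) (TangentBundle 𝓘(ℝ, E) Q))) M ↔
      ContMDiffOn (modelW E) (modelW E).tangent ∞
        (fun w => (⟨w, X w⟩ : TangentBundle (modelW E) (WhitneySum E Q))) (Mtilde L M) := by
  constructor
  · intro h
    have h1 := ((contMDiff_legGraph hL).contMDiff_tangentMap (m := ∞) (by simp)).comp_contMDiffOn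
      (h.comp (contMDiff_pr₂ (E := E) (Q := Q)).contMDiffOn (fun w (hw : w ∈ Mtilde L M) => hw.1))
    refine h1.congr fun w hw => ?_
    -- The base point is generalised because `w` equals `legGraph L (pr₂ w)` only propositionally.
    have h2 : ∀ w', w' = legGraph L (pr₂ w) →
        (⟨w', X w'⟩ : TangentBundle (modelW E) (WhitneySum E Q)) =
          ⟨legGraph L (pr₂ w), dlegGraph L (pr₂ w) (Γ (pr₂ w))⟩ := by
      rintro _ rfl
      exact congrArg (TotalSpace.mk (legGraph L (pr₂ w))) (hX _ hw.1)
    exact h2 w (eq_legGraph_of_mem_Mtilde hw)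
  · intro h
    have h1 := (contMDiff_pr₂ (E := E) (Q := Q)).contMDiff_tangentMap (m := ∞) (by simp)
      |>.comp_contMDiffOn
      (h.comp (contMDiff_legGraph hL).contMDiffOn (fun v (hv : v ∈ M) => legGraph_mem_Mtilde hv))
    refine h1.congr fun v hv => ?_
    exact congrArg (TotalSpace.mk v) (mfderiv_pr₂_of_related hL hX hv).symm

end Fields

end NonholonomicSR

end

/-! ### Assembly of the statements. -/

theorem mainTheorem7
    {E : Type*} [NormedAddCommGroup E] [NormedSpace ℝ E] [FiniteDimensional ℝ E]
    {Q : Type*} [TopologicalSpace Q] [ChartedSpace E Q] [IsManifold 𝓘(ℝ, E) ∞ Q]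
    (L : TangentBundle 𝓘(ℝ, E) Q → ℝ) (hL : ContMDiff (modelT E) 𝓘(ℝ, ℝ) ∞ L)
    (m : ℕ) (M : Set (TangentBundle 𝓘(ℝ, E) Q))
    (hM : IsSubmanifold (modelT E) M m) (hadm : Admissible M) :
    -- the points of `T*Q ×_Q M` where the equations have a solution form `M̃`
    {w | w ∈ W₀ M ∧ ∃ X, SkinnerRuskFormAt L M w X} = Mtilde L M ∧
    {w | w ∈ W₀ M ∧ ∃ X, SkinnerRuskAt L M w X} = Mtilde L M ∧
    -- `M̃` is a submanifold, diffeomorphic to `M`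
    IsSubmanifold (modelW E) (Mtilde L M) (Module.finrank ℝ E + m) ∧
    IsDiffeoBetween (modelT E) (modelW E) (legGraph L) pr₂ M (Mtilde L M) ∧
    -- pointwise equivalence
    (∀ v ∈ M, BijOn (dlegGraph L v)
      {Γ | NonholonomicAt L M v Γ ∧ IsSecondOrderAt v Γ}
      {X | SkinnerRuskAt L M (legGraph L v) X ∧
        X ∈ tangentTo (modelW E) (Mtilde L M) (legGraph L v)}) ∧
    -- equivalence for vector fields that correspond under the diffeomorphism `M ≃ M̃`
    (∀ (Γ : ∀ v : TangentBundle 𝓘(ℝ, E) Q, TangentSpace (modelT E) v)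
      (X : ∀ w : WhitneySum E Q, TangentSpace (modelW E) w),
      (∀ v ∈ M, X (legGraph L v) = dlegGraph L v (Γ v)) →
      ((∀ v ∈ M, NonholonomicAt L M v (Γ v) ∧ IsSecondOrderAt v (Γ v)) ↔
        ∀ w ∈ Mtilde L M, SkinnerRuskAt L M w (X w)) ∧
      ((∀ v ∈ M, Γ v ∈ tangentTo (modelT E) M v) ↔
        ∀ w ∈ Mtilde L M, X w ∈ tangentTo (modelW E) (Mtilde L M) w) ∧
      (ContMDiffOn (modelT E) (modelT E).tangent ∞
          (fun v => (⟨v, Γ v⟩ : TangentBundle (modelT E) (TangentBundle 𝓘(ℝ, E) Q))) M ↔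
        ContMDiffOn (modelW E) (modelW E).tangent ∞
          (fun w => (⟨w, X w⟩ : TangentBundle (modelW E) (WhitneySum E Q))) (Mtilde L M)) ∧
      -- for regular `L` no second-order condition is needed
      ((∀ v ∈ M, RegularAt L v) →
        ((∀ v ∈ M, NonholonomicAt L M v (Γ v)) ↔
          ∀ w ∈ Mtilde L M, SkinnerRuskAt L M w (X w)))) ∧
    ((∀ v ∈ M, RegularAt L v) →
      ∀ v ∈ M, ∀ Γ, NonholonomicAt L M v Γ → IsSecondOrderAt v Γ) ∧
    -- equivalence for trajectories
    (∀ (J : Set ℝ) (w : ℝ → WhitneySum E Q), IsOpen J →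
      (∀ t ∈ J, MDifferentiableAt 𝓘(ℝ, ℝ) (modelW E) w t) →
      ((∀ t ∈ J, w t ∈ W₀ M ∧ SkinnerRuskAt L M (w t) (velocity (modelW E) w t)) ↔
        ∀ t ∈ J, w t = legGraph L (pr₂ (w t)) ∧ pr₂ (w t) ∈ M ∧
          NonholonomicAt L M (pr₂ (w t)) (velocity (modelT E) (fun s => pr₂ (w s)) t) ∧
          IsSecondOrderAt (pr₂ (w t)) (velocity (modelT E) (fun s => pr₂ (w s)) t))) := by
  have hso : (∀ v ∈ M, RegularAt L v) → ∀ v ∈ M, ∀ Γ, NonholonomicAt L M v Γ →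
      IsSecondOrderAt v Γ := fun hr v hv _ hΓ => isSecondOrderAt_of_regularAt hL (hr v hv) hΓ
  refine ⟨?_, ?_, isSubmanifold_Mtilde hL hM, isDiffeoBetween_legGraph hL,
    fun v hv => bijOn_dlegGraph hL hv, fun Γ X hX => ?_, hso,
    fun J w hJ hw => trajectory_iff hL hJ hw⟩
  · refine Subset.antisymm (fun w hw => ?_) (fun w hw => ⟨hw.1, ?_⟩)
    · obtain ⟨X, hX⟩ := hw.2
      exact mem_Mtilde_of_skinnerRuskFormAt hL hw.1 hX
    · obtain ⟨X, hX⟩ := exists_skinnerRuskAt hL hadm hw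
      exact ⟨X, hX.1⟩
  · refine Subset.antisymm (fun w hw => ?_) (fun w hw => ⟨hw.1, exists_skinnerRuskAt hL hadm hw⟩)
    obtain ⟨X, hX⟩ := hw.2
    exact mem_Mtilde_of_skinnerRuskFormAt hL hw.1 hX.1
  · have hSR : (∀ v ∈ M, NonholonomicAt L M v (Γ v) ∧ IsSecondOrderAt v (Γ v)) ↔
        ∀ w ∈ Mtilde L M, SkinnerRuskAt L M w (X w) := by
      rw [forall_mem_Mtilde_iff]
      refine forall₂_congr fun v hv => ?_
      rw [hX v hv]
      exact (skinnerRuskAt_dlegGraph_iff hL hv (Γ v)).symm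
    refine ⟨hSR, tangent_iff_of_related hL hX, contMDiffOn_iff_of_related hL hX, fun hr => ?_⟩
    rw [← hSR]
    exact forall₂_congr fun v hv => ⟨fun h => ⟨h, hso hr v hv _ h⟩, fun h => h.1⟩
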